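/- **Setting.** A $\frac{\mathbb Z}{2}$-graded meromorphic open-string vertex algebra (MOSVA) is a complex vector space $V=\coprod_{n\in\frac12\mathbb Z}V_{(n)}$ with $V_{(n)}=0$ for $n$ sufficiently negative, a bilinear map $Y_V(u,x)v=\sum_{n\in\mathbb Z}u_nv\,x^{-n-1}\in V[[x,x^{-1}]]$ and a vacuum $\mathbf 1\in V$ such that, with $\mathbf d_Vv=nv$ for $v\in V_{(n)}$ and $D_Vv=\lim_{x\to0}\frac{d}{dx}Y_V(v,x)\mathbf 1=v_{-2}\mathbf 1$: * $[\mathbf d_V,Y_V(u,x)]=Y_V(\mathbf d_Vu,x)+x\frac{d}{dx}Y_V(u,x)$; * $Y_V(\mathbf 1,x)=1_V$, $Y_V(u,x)\mathbf 1\in V[[x]]$ and $\lim_{x\to0}Y_V(u,x)\mathbf 1=u$; * $\frac{d}{dx}Y_V(u,x)=Y_V(D_Vu,x)=[D_V,Y_V(u,x)]$; * for all $u_1,v\in V$ there is $P\in\mathbb N$ such that for all $u_2\in V$, $(x_0+x_2)^PY_V(u_1,x_0+x_2)Y_V(u_2,x_2)v=(x_0+x_2)^PY_V(Y_V(u_1,x_0)u_2,x_2)v$.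 The parity of a homogeneous $v\in V_{(n)}$ is $|v|=0$ if $n\in\mathbb Z$ and $|v|=1$ if $n\in\mathbb Z+\frac12$. An involution of $V$ is a grading-preserving linear isomorphism $\theta$ with $\theta^2=1_V$ and $\theta(Y_V(u,x)v)=Y_V(\theta u,x)\theta v$. Let $V$ be a $\frac{\mathbb Z}{2}$-graded MOSVA and $\theta$ an involution of $V$. Let $W=\coprod_{n\in\mathbb C}W_{(n)}$ be a $\mathbb C$-graded vector space with a bilinear map $Y(v,x)w=\sum_{n\in\frac12\mathbb Z}v_nw\,x^{-n-1}\in W[[x^{1/2},x^{-1/2}]]$ ($v\in V$, $w\in W$), an operator $\mathbf d_W$ of weight $0$ and an operator $D_W$ of weight $1$, satisfying all axioms of a $\theta$-twisted $V$-module except weak associativity, that is: $W_{(m)}=0$ when $\operatorname{Re} m$ is sufficiently negative; $\mathbf d_Ww=mw$ for $w\in W_{(m)}$; $[\mathbf d_W,Y(u,x)]=Y(\mathbf d_Vu,x)+x\frac{d}{dx}Y(u,x)$; $Y(\mathbf 1,x)=1_W$; and $\frac{d}{dx}Y(u,x)=Y(D_Vu,x)$. For $z\in\mathbb C^\times$ and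 $p\in\mathbb Z$ let $l_p(z)=\log|z|+i(\arg z+2\pi p)$ with $\arg z\in[0,2\pi)$, let $(z^s)_p=e^{s\,l_p(z)}$, and let $Y^p(v,z)=\sum_{n\in\frac12\mathbb Z}v_n\,(z^{-n-1})_p$. Let $W'=\coprod_{n\in\mathbb C}W_{(n)}^*$ be the restricted dual. **Proposition.** The following two conditions are equivalent. 1. (Weak associativity with pole-order condition.) For every homogeneous $v_1\in V$ and every $w\in W$ there exists $P\in\mathbb N$ such that for every homogeneous $v_2\in V$ $$(x_0+x_2)^{P+|v_1|/2}x_2^{|v_2|/2}\,Y(v_1,x_0+x_2)Y(v_2,x_2)w=(x_0+x_2)^{P+|v_1|/2}x_2^{|v_2|/2}\,Y(Y_V(v_1,x_0)v_2,x_2)w$$ as series in $W((x_0,x_2))=W[[x_0,x_2]][x_0^{-1},x_2^{-1}]$. Here on the left-hand side the powers of $x_0+x_2$, after being multiplied together, are expanded in nonnegative integral powers of $x_2$, and on the right-hand side $(x_0+x_2)^{P+|v_1|/2}$ is expanded in nonnegative integral powers of $x_0$. 2. (Associativity.) For all homogeneous $v_1,v_2\in V$ and all $w\in W$, $w'\in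 W'$ there is an algebraic function $$f(z_1,z_2)=z_1^{|v_1|/2}z_2^{|v_2|/2}\,\frac{g(z_1,z_2)}{z_1^{q_1}z_2^{q_2}(z_1-z_2)^{q_{12}}},$$ where $g$ is a complex polynomial and $q_1,q_2,q_{12}\in\mathbb N$ depend respectively only on the pairs $(v_1,w)$, $(v_2,w)$, $(v_1,v_2)$, such that for every $p\in\mathbb Z$ the series $$\langle w',Y^p(v_1,z_1)Y^p(v_2,z_2)w\rangle=\sum_{m,n\in\frac12\mathbb Z}\langle w',(v_1)_m(v_2)_nw\rangle\,(z_1^{-m-1})_p(z_2^{-n-1})_p$$ converges absolutely in the region $|z_1|>|z_2|>0$, and the series $$\langle w',Y^p(Y_V(v_1,z_1-z_2)v_2,z_2)w\rangle=\sum_{m\in\mathbb Z,\,n\in\frac12\mathbb Z}\langle w',((v_1)_mv_2)_nw\rangle\,(z_1-z_2)^{-m-1}(z_2^{-n-1})_p$$ converges absolutely in the region $|z_2|>|z_1-z_2|>0$, $|\arg z_1-\arg z_2|<\pi/2$, both to the $p$-th branch $$f^{p,p}(z_1,z_2)=(z_1^{|v_1|/2})_p\,(z_2^{|v_2|/2})_p\,\frac{g(z_1,z_2)}{z_1^{q_1}z_2^{q_2}(z_1-z_2)^{q_{12}}}.$$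 -/

import Mathlib

/-- A `½ℤ`-graded meromorphic open-string vertex algebra structure on the complex vector space `V`.
`wt j` is the homogeneous subspace `V_(j/2)` of weight `j/2`, and `Y n u v` is `u_n v`, the
coefficient of `x^(-n-1)` in `Y_V(u, x) v ∈ V[[x, x⁻¹]]`. -/
structure HalfMOSVA (V : Type*) [AddCommGroup V] [Module ℂ V] where
  /-- the homogeneous subspace of weight `j/2` -/
  wt : ℤ → Submodule ℂ V
  isInternal : DirectSum.IsInternal wt
  /-- the vertex operator map -/
  Y : ℤ → V →ₗ[ℂ] V →ₗ[ℂ] V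
  /-- the vacuum -/
  vac : V
  /-- the weight operator `d_V`; it is determined by `d_apply` -/
  d : V →ₗ[ℂ] V
  d_apply : ∀ (j : ℤ), ∀ v ∈ wt j, d v = ((j : ℂ) / 2) • v
  lower_bound : ∃ N : ℤ, ∀ j : ℤ, j < N → wt j = ⊥
  /-- `[d_V, Y_V(u,x)] = Y_V(d_V u, x) + x (d/dx) Y_V(u,x)` -/
  d_comm : ∀ (u v : V) (n : ℤ),
    d (Y n u v) - Y n u (d v) = Y n (d u) v + (-(n : ℂ) - 1) • Y n u v
  /-- `Y_V(1, x) = 1_V` -/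
  identity : ∀ (n : ℤ) (v : V), Y n vac v = if n = -1 then v else 0
  /-- `Y_V(u, x)1 ∈ V[[x]]` -/
  creation : ∀ (u : V) (n : ℤ), 0 ≤ n → Y n u vac = 0
  /-- `lim_{x → 0} Y_V(u, x)1 = u` -/
  creation_lim : ∀ u : V, Y (-1) u vac = u
  /-- `(d/dx) Y_V(u, x) = Y_V(D_V u, x)`, where `D_V u = lim_{x → 0} (d/dx) Y_V(u, x)1 = u_{-2} 1` -/
  D_derivative : ∀ (u v : V) (n : ℤ), Y n (Y (-2) u vac) v = (-(n : ℂ)) • Y (n - 1) u v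
  /-- `[D_V, Y_V(u, x)] = (d/dx) Y_V(u, x)` -/
  D_comm : ∀ (u v : V) (n : ℤ),
    Y (-2) (Y n u v) vac - Y n u (Y (-2) v vac) = (-(n : ℂ)) • Y (n - 1) u v
  /-- Weak associativity with pole-order condition:
  `(x₀+x₂)^P Y_V(u₁, x₀+x₂) Y_V(u₂, x₂) v = (x₀+x₂)^P Y_V(Y_V(u₁, x₀) u₂, x₂) v`,
  as an equality of the coefficients of `x₀^a x₂^b`, where `P` depends only on `u₁` and `v`.
  On the left, powers of `x₀+x₂` are expanded in nonnegative powers of `x₂`. -/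
  weak_assoc : ∀ u₁ v : V, ∃ P : ℕ, ∀ (u₂ : V) (a b : ℤ),
    ∑ᶠ k : ℕ, Ring.choose ((a : ℂ) + k) k • Y (P - 1 - a - k) u₁ (Y (k - 1 - b) u₂ v) =
    ∑ᶠ k : ℕ, Ring.choose (P : ℂ) k • Y (P - 1 - k - b) (Y (k - 1 - a) u₁ u₂) v

/-- An involution `θ` of a `½ℤ`-graded MOSVA. -/
structure HalfMOSVA.Involution {V : Type*} [AddCommGroup V] [Module ℂ V] (A : HalfMOSVA V) where
  toEquiv : V ≃ₗ[ℂ] V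
  map_wt : ∀ (j : ℤ), ∀ v ∈ A.wt j, toEquiv v ∈ A.wt j
  sq : ∀ v : V, toEquiv (toEquiv v) = v
  map_Y : ∀ (n : ℤ) (u v : V), toEquiv (A.Y n u v) = A.Y n (toEquiv u) (toEquiv v)

/-- The data of a `θ`-twisted `V`-module on the complex vector space `W`, with all axioms
except weak associativity.
`wt m` is the homogeneous subspace `W_(m)`, and `Y k v w` is `v_{k/2} w`, the coefficient of
`x^(-k/2-1)` in `Y_W^θ(v, x) w ∈ W[[x^{1/2}, x^{-1/2}]]`. -/
structure PreTwistedModule {V : Type*} [AddCommGroup V] [Module ℂ V] (A : HalfMOSVA V)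
    (θ : A.Involution) (W : Type*) [AddCommGroup W] [Module ℂ W] where
  /-- the homogeneous subspace of weight `m` -/
  wt : ℂ → Submodule ℂ W
  isInternal : DirectSum.IsInternal wt
  /-- the twisted vertex operator map -/
  Y : ℤ → V →ₗ[ℂ] W →ₗ[ℂ] W
  /-- the operator `d_W` (of weight `0` by `d_apply`) -/
  d : W →ₗ[ℂ] W
  /-- the operator `D_W` of weight `1` -/
  D : W →ₗ[ℂ] W
  D_weight : ∀ (m : ℂ), ∀ w ∈ wt m, D w ∈ wt (m + 1)
  lower_bound : ∃ N : ℝ, ∀ m : ℂ, m.re < N → wt m = ⊥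
  /-- the `d`-grading condition -/
  d_apply : ∀ (m : ℂ), ∀ w ∈ wt m, d w = m • w
  /-- `[d_W, Y_W(u,x)] = Y_W(d_V u, x) + x (d/dx) Y_W(u,x)` -/
  d_comm : ∀ (u : V) (w : W) (k : ℤ),
    d (Y k u w) - Y k u (d w) = Y k (A.d u) w + (-((k : ℂ) / 2) - 1) • Y k u w
  /-- `Y_W(1, x) = 1_W` -/
  identity : ∀ (k : ℤ) (w : W), Y k A.vac w = if k = -2 then w else 0
  /-- `(d/dx) Y_W(u, x) = Y_W(D_V u, x)`, where `D_V u = u_{-2} 1` -/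
  D_derivative : ∀ (u : V) (w : W) (k : ℤ),
    Y k (A.Y (-2) u A.vac) w = (-((k : ℂ) / 2)) • Y (k - 2) u w

/-- The parity `|v| ∈ {0, 1}` of an element `v` of weight `j/2`: it is `0` if `j/2 ∈ ℤ` and `1` if
`j/2 ∈ ℤ + 1/2`. -/
def weightParity (j : ℤ) : ℕ := if Even j then 0 else 1

/-- `arg z ∈ [0, 2π)`. -/
noncomputable def argNonneg (z : ℂ) : ℝ :=
  if 0 ≤ z.arg then z.arg else z.arg + 2 * Real.pi

/-- The `p`-th branch `l_p(z) = log |z| + i (arg z + 2πp)`, `arg z ∈ [0, 2π)`, of the logarithm. -/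
noncomputable def branchLog (p : ℤ) (z : ℂ) : ℂ :=
  (Real.log ‖z‖ : ℂ) + Complex.I * ((argNonneg z : ℂ) + 2 * Real.pi * p)

/-- The `p`-th branch `(z^s)_p = e^{s l_p(z)}` of `z^s`. -/
noncomputable def branchPow (p : ℤ) (z s : ℂ) : ℂ := Complex.exp (s * branchLog p z)

/-- Absolute convergence of the series `∑ c i` to the sum `s`. -/
def ConvergesAbsolutelyTo {ι : Type*} (c : ι → ℂ) (s : ℂ) : Prop :=
  Summable (fun i => ‖c i‖) ∧ HasSum c s

/-- In an internally graded space on which `d` acts by the scalar `c i` on `G i`, every eigenvalue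
of `d` is some `c i` with `G i ≠ 0`. -/
theorem eigenvalue_mem_weights {ι W : Type*} [DecidableEq ι] [AddCommGroup W] [Module ℂ W]
    (G : ι → Submodule ℂ W) (hG : DirectSum.IsInternal G) (c : ι → ℂ) (d : W →ₗ[ℂ] W)
    (hd : ∀ i, ∀ w ∈ G i, d w = c i • w) (e : ℂ) (w : W) (hw : d w = e • w) (hw0 : w ≠ 0) :
    ∃ i, e = c i ∧ G i ≠ ⊥ := by
  classical
  obtain ⟨f, rfl⟩ := hG.2 w
  have hd' : ∀ g : DirectSum ι (fun j => G j), d (DirectSum.coeAddMonoidHom G g) =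
      DirectSum.coeAddMonoidHom G
        (DFinsupp.mapRange (fun j (x : G j) => c j • x) (by simp) g) := by
    intro g
    induction g using DirectSum.induction_on with
    | zero =>
      rw [map_zero, map_zero]
      symm
      convert map_zero (DirectSum.coeAddMonoidHom G)
      exact DFinsupp.mapRange_zero _ _
    | of j x =>
      have : DFinsupp.mapRange (fun j (x : G j) => c j • x) (by simp)
          (DirectSum.of (fun j => G j) j x) =
          DirectSum.of (fun j => G j) j (c j • x) :=
        DFinsupp.mapRange_single
      rw [this, DirectSum.coeAddMonoidHom_of, DirectSum.coeAddMonoidHom_of, hd j x x.2]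
      rfl
    | add x y hx hy =>
      rw [map_add, map_add, hx, hy, ← map_add]
      congr 1
      symm
      exact DFinsupp.mapRange_add _ _ (by intro i a b; simp) x y
  have hf0 : f ≠ 0 := by rintro rfl; exact hw0 (map_zero _)
  obtain ⟨j, hj⟩ : ∃ j, f j ≠ 0 := by
    by_contra h
    push Not at h
    exact hf0 (DFinsupp.ext h)
  have hs : e • DirectSum.coeAddMonoidHom G f = DirectSum.coeAddMonoidHom G (e • f) :=
    ((DirectSum.coeLinearMap G).map_smul e f).symm
  rw [hd', hs] at hw
  have h2 : c j • f j = e • f j := DFunLike.congr_fun (hG.1 hw) j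
  refine ⟨j, ?_, ?_⟩
  · have h3 : (e - c j) • f j = 0 := by rw [sub_smul, h2, sub_self]
    rcases smul_eq_zero.1 h3 with h | h
    · exact sub_eq_zero.1 h
    · exact absurd h hj
  · intro hb
    apply hj
    have h4 : ((f j : G j) : W) ∈ (⊥ : Submodule ℂ W) := hb ▸ (f j).2
    exact Subtype.ext ((Submodule.mem_bot ℂ).1 h4)

/-- The grading axioms imply that `Y(u, x) w` has only finitely many negative powers of `x`. -/
theorem lower_truncation {ι κ U W : Type*} [DecidableEq ι] [DecidableEq κ]
    [AddCommGroup U] [Module ℂ U] [AddCommGroup W] [Module ℂ W]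
    (F : ι → Submodule ℂ U) (hF : DirectSum.IsInternal F) (cU : ι → ℂ) (dU : U →ₗ[ℂ] U)
    (hdU : ∀ i, ∀ u ∈ F i, dU u = cU i • u)
    (G : κ → Submodule ℂ W) (hG : DirectSum.IsInternal G) (cW : κ → ℂ) (dW : W →ₗ[ℂ] W)
    (hdW : ∀ i, ∀ w ∈ G i, dW w = cW i • w)
    (L : ℝ) (hL : ∀ i, (cW i).re < L → G i = ⊥) (t : ℝ) (ht : 0 < t)
    (Y : ℤ → U →ₗ[ℂ] W →ₗ[ℂ] W)
    (hY : ∀ (u : U) (w : W) (n : ℤ),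
      dW (Y n u w) - Y n u (dW w) = Y n (dU u) w + (-((t : ℂ) * n) - 1) • Y n u w)
    (u : U) (w : W) : ∃ N : ℤ, ∀ n : ℤ, N < n → Y n u w = 0 := by
  have hu : u ∈ ⨆ j, F j := by rw [hF.submodule_iSup_eq_top]; trivial
  have hw : w ∈ ⨆ j, G j := by rw [hG.submodule_iSup_eq_top]; trivial
  induction hu using Submodule.iSup_induction' with
  | zero => exact ⟨0, by simp⟩
  | add x y _ _ hx hy =>
    obtain ⟨N, hN⟩ := hx
    obtain ⟨M, hM⟩ := hy
    refine ⟨max N M, fun n hn => ?_⟩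
    rw [map_add, LinearMap.add_apply, hN n (lt_of_le_of_lt (le_max_left _ _) hn),
      hM n (lt_of_le_of_lt (le_max_right _ _) hn), add_zero]
  | mem i u hu =>
    induction hw using Submodule.iSup_induction' with
    | zero => exact ⟨0, by simp⟩
    | add x y _ _ hx hy =>
      obtain ⟨N, hN⟩ := hx
      obtain ⟨M, hM⟩ := hy
      refine ⟨max N M, fun n hn => ?_⟩
      rw [map_add, hN n (lt_of_le_of_lt (le_max_left _ _) hn),
        hM n (lt_of_le_of_lt (le_max_right _ _) hn), add_zero]
    | mem j w hw =>
      obtain ⟨N, hN⟩ := exists_int_gt (((cU i).re + (cW j).re - 1 - L) / t)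
      refine ⟨N, fun n hn => ?_⟩
      by_contra h0
      have h1 := hY u w n
      rw [hdU i u hu, hdW j w hw] at h1
      simp only [map_smul, LinearMap.smul_apply] at h1
      have h2 : dW (Y n u w) = (cU i + cW j - (t : ℂ) * n - 1) • Y n u w := by
        rw [sub_eq_iff_eq_add] at h1
        rw [h1]; module
      obtain ⟨l, hl, hl'⟩ := eigenvalue_mem_weights G hG cW dW hdW _ _ h2 h0
      apply hl'
      apply hL
      rw [← hl]
      have h3 : ((N : ℤ) : ℝ) < n := by exact_mod_cast hn
      have h4 := (div_lt_iff₀ ht).1 (hN.trans h3)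
      simp
      linarith

theorem HalfMOSVA.truncation {V : Type*} [AddCommGroup V] [Module ℂ V] (A : HalfMOSVA V)
    (u v : V) : ∃ N : ℤ, ∀ n : ℤ, N < n → A.Y n u v = 0 := by
  obtain ⟨L, hL⟩ := A.lower_bound
  refine lower_truncation A.wt A.isInternal (fun j => (j : ℂ) / 2) A.d A.d_apply
    A.wt A.isInternal (fun j => (j : ℂ) / 2) A.d A.d_apply ((L : ℝ) / 2) ?_ 1 one_pos A.Y ?_ u v
  · intro j hj
    apply hL
    simp at hj
    have : (j : ℝ) < L := by linarith
    exact_mod_cast this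
  · intro u w n
    simpa using A.d_comm u w n

namespace PreTwistedModule

variable {V : Type*} [AddCommGroup V] [Module ℂ V] {A : HalfMOSVA V} {θ : A.Involution}
  {W : Type*} [AddCommGroup W] [Module ℂ W]

theorem truncation (M : PreTwistedModule A θ W)
    (u : V) (w : W) : ∃ N : ℤ, ∀ n : ℤ, N < n → M.Y n u w = 0 := by
  classical
  obtain ⟨L, hL⟩ := M.lower_bound
  refine lower_truncation A.wt A.isInternal (fun j => (j : ℂ) / 2) A.d A.d_apply
    M.wt M.isInternal id M.d M.d_apply L hL (1 / 2) (by norm_num) M.Y ?_ u w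
  intro u w n
  rw [M.d_comm u w n]
  congr 2
  push_cast
  ring

/-- For `v₁, v₂` of parities `ε₁, ε₂`, the coefficient of `x₀^{a/2} x₂^{b/2}` in
`(x₀+x₂)^{P + ε₁/2} x₂^{ε₂/2} Y_W(v₁, x₀+x₂) Y_W(v₂, x₂) w`.
This series is obtained from `x₁^{P + ε₁/2} x₂^{ε₂/2} Y_W(v₁, x₁) Y_W(v₂, x₂) w` by replacing every
power `x₁^s` by `(x₀+x₂)^s = ∑_k binom(s, k) x₀^{s-k} x₂^k`. The term with
index `k` comes from `s = a/2 + k`. -/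
noncomputable def productCoeff (M : PreTwistedModule A θ W) (P ε₁ ε₂ : ℕ) (v₁ v₂ : V) (w : W)
    (a b : ℤ) : W :=
  ∑ᶠ k : ℕ, Ring.choose ((a : ℂ) / 2 + k) k •
    M.Y (2 * P + ε₁ - 2 - 2 * k - a) v₁ (M.Y (ε₂ - 2 + 2 * k - b) v₂ w)

/-- For `v₁, v₂` of parities `ε₁, ε₂`, the coefficient of `x₀^{a/2} x₂^{b/2}` in
`(x₀+x₂)^{P + ε₁/2} x₂^{ε₂/2} Y_W(Y_V(v₁, x₀) v₂, x₂) w`,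
where `(x₀+x₂)^{P + ε₁/2} = ∑_k binom(P + ε₁/2, k) x₀^k x₂^{P + ε₁/2 - k}`.
Only integral powers of `x₀` occur. -/
noncomputable def iterateCoeff (M : PreTwistedModule A θ W) (P ε₁ ε₂ : ℕ) (v₁ v₂ : V) (w : W)
    (a b : ℤ) : W :=
  if Even a then
    ∑ᶠ k : ℕ, Ring.choose ((P : ℂ) + ε₁ / 2) k •
      M.Y (2 * P + ε₁ + ε₂ - 2 - 2 * k - b) (A.Y (k - 1 - a / 2) v₁ v₂) w
  else 0

/-- The sums over `k` in `productCoeff` are finite. -/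
theorem productCoeff_support_finite (M : PreTwistedModule A θ W) (P ε₁ ε₂ : ℕ) (v₁ v₂ : V) (w : W)
    (a b : ℤ) : (Function.support fun k : ℕ => Ring.choose ((a : ℂ) / 2 + k) k •
      M.Y (2 * P + ε₁ - 2 - 2 * k - a) v₁ (M.Y (ε₂ - 2 + 2 * k - b) v₂ w)).Finite := by
  obtain ⟨N, hN⟩ := M.truncation v₂ w
  refine (Set.finite_Iic (N + 2 + b).toNat).subset fun k hk => ?_
  by_contra h
  apply hk
  simp only [Set.mem_Iic, not_le] at h
  have h1 : N < (ε₂ : ℤ) - 2 + 2 * k - b := by omega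
  simp [hN _ h1]

/-- The sums over `k` in `iterateCoeff` are finite. -/
theorem iterateCoeff_support_finite (M : PreTwistedModule A θ W) (P ε₁ ε₂ : ℕ) (v₁ v₂ : V) (w : W)
    (a b : ℤ) : (Function.support fun k : ℕ => Ring.choose ((P : ℂ) + ε₁ / 2) k •
      M.Y (2 * P + ε₁ + ε₂ - 2 - 2 * k - b) (A.Y (k - 1 - a / 2) v₁ v₂) w).Finite := by
  obtain ⟨N, hN⟩ := A.truncation v₁ v₂
  refine (Set.finite_Iic (N + 1 + a / 2).toNat).subset fun k hk => ?_
  by_contra h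
  apply hk
  simp only [Set.mem_Iic, not_le] at h
  have h1 : N < (k : ℤ) - 1 - a / 2 := by omega
  simp [hN _ h1]

/-- Weak associativity with pole-order condition: for every homogeneous `v₁` and every `w` there is
`P` such that for every homogeneous `v₂` the two series are equal, and they
lie in `W((x₀, x₂)) = W[[x₀, x₂]][x₀⁻¹, x₂⁻¹]`. -/
def WeakAssociativity (M : PreTwistedModule A θ W) : Prop :=
  ∀ (j₁ : ℤ), ∀ v₁ ∈ A.wt j₁, ∀ w : W, ∃ P : ℕ, ∀ (j₂ : ℤ), ∀ v₂ ∈ A.wt j₂,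
    (∀ a b : ℤ, M.productCoeff P (weightParity j₁) (weightParity j₂) v₁ v₂ w a b =
      M.iterateCoeff P (weightParity j₁) (weightParity j₂) v₁ v₂ w a b) ∧
    ∃ N : ℤ, ∀ a b : ℤ,
      M.iterateCoeff P (weightParity j₁) (weightParity j₂) v₁ v₂ w a b ≠ 0 →
        Even a ∧ Even b ∧ N ≤ a ∧ N ≤ b

/-- The restricted dual `W' = ∐ₙ W_(n)^*`: the linear functionals on `W` that vanish on all but
finitely many of the homogeneous subspaces. -/
def restrictedDual (M : PreTwistedModule A θ W) : Set (Module.Dual ℂ W) :=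
  {w' | {m : ℂ | ∃ w ∈ M.wt m, w' w ≠ 0}.Finite}

/-- The terms of the series
`⟨w', Y_W^p(v₁, z₁) Y_W^p(v₂, z₂) w⟩
  = ∑_{m, n ∈ ½ℤ} ⟨w', (v₁)_m (v₂)_n w⟩ (z₁^{-m-1})_p (z₂^{-n-1})_p`,
indexed by `(k, l) = (2m, 2n)`. -/
noncomputable def productTerm (M : PreTwistedModule A θ W) (p : ℤ) (w' : Module.Dual ℂ W)
    (v₁ v₂ : V) (w : W) (z₁ z₂ : ℂ) (i : ℤ × ℤ) : ℂ :=
  w' (M.Y i.1 v₁ (M.Y i.2 v₂ w)) *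
    branchPow p z₁ (-((i.1 : ℂ) / 2) - 1) * branchPow p z₂ (-((i.2 : ℂ) / 2) - 1)

/-- The terms of the series
`⟨w', Y_W^p(Y_V(v₁, z₁-z₂) v₂, z₂) w⟩
  = ∑_{m ∈ ℤ, n ∈ ½ℤ} ⟨w', ((v₁)_m v₂)_n w⟩ (z₁-z₂)^{-m-1} (z₂^{-n-1})_p`,
indexed by `(m, l) = (m, 2n)`. -/
noncomputable def iterateTerm (M : PreTwistedModule A θ W) (p : ℤ) (w' : Module.Dual ℂ W)
    (v₁ v₂ : V) (w : W) (z₁ z₂ : ℂ) (i : ℤ × ℤ) : ℂ :=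
  w' (M.Y i.2 (A.Y i.1 v₁ v₂) w) *
    (z₁ - z₂) ^ (-i.1 - 1) * branchPow p z₂ (-((i.2 : ℂ) / 2) - 1)

/-- The `p`-th branch
`f^{p,p}(z₁, z₂) = (z₁^{ε₁/2})_p (z₂^{ε₂/2})_p g(z₁, z₂) / (z₁^{q₁} z₂^{q₂} (z₁-z₂)^{q₁₂})`. -/
noncomputable def correlationBranch (p : ℤ) (ε₁ ε₂ : ℕ) (g : MvPolynomial (Fin 2) ℂ)
    (q₁ q₂ q₁₂ : ℕ) (z₁ z₂ : ℂ) : ℂ :=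
  branchPow p z₁ ((ε₁ : ℂ) / 2) * branchPow p z₂ ((ε₂ : ℂ) / 2) *
    (MvPolynomial.eval ![z₁, z₂] g / (z₁ ^ q₁ * z₂ ^ q₂ * (z₁ - z₂) ^ q₁₂))

/-- The associativity axiom. The exponents are given by functions `q₁`, `q₂`, `q₁₂` of the pairs
`(v₁, w)`, `(v₂, w)`, `(v₁, v₂)`, and the polynomial `g` serves all branches `p` at once. -/
def Associativity (M : PreTwistedModule A θ W) : Prop :=
  ∃ (q₁ q₂ : V → W → ℕ) (q₁₂ : V → V → ℕ),
    ∀ (j₁ j₂ : ℤ), ∀ v₁ ∈ A.wt j₁, ∀ v₂ ∈ A.wt j₂, ∀ w : W, ∀ w' ∈ M.restrictedDual,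
      ∃ g : MvPolynomial (Fin 2) ℂ, ∀ (p : ℤ) (z₁ z₂ : ℂ),
        (0 < ‖z₂‖ → ‖z₂‖ < ‖z₁‖ →
          ConvergesAbsolutelyTo (M.productTerm p w' v₁ v₂ w z₁ z₂)
            (correlationBranch p (weightParity j₁) (weightParity j₂) g
              (q₁ v₁ w) (q₂ v₂ w) (q₁₂ v₁ v₂) z₁ z₂)) ∧
        (0 < ‖z₁ - z₂‖ → ‖z₁ - z₂‖ < ‖z₂‖ → |argNonneg z₁ - argNonneg z₂| < Real.pi / 2 →
          ConvergesAbsolutelyTo (M.iterateTerm p w' v₁ v₂ w z₁ z₂)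
            (correlationBranch p (weightParity j₁) (weightParity j₂) g
              (q₁ v₁ w) (q₂ v₂ w) (q₁₂ v₁ v₂) z₁ z₂))

end PreTwistedModule

/-! Everything is tested against `w' ∈ W'`. Such a functional sees finitely many weights, so the
coefficients of each correlation series live in finitely many total degrees.

Two formal operations occur in weak associativity. The substitution `x₁ = x₀ + x₂` moves doubled
exponents along the ray `(2, -2)`, and multiplication by `(x₀ + x₂)^(P + ε₁/2)` moves them along
`(-2, 2)`. On series truncated in the right direction both are invertible, the inverses being the
expansions of `(x₁ - x₂)^(s/2)` and of `(x₂ + x₀)^(-P - ε₁/2)` (`shiftSum_eq_iff_eq_rayExpansion`).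

Hence both sides of weak associativity, paired with `w'`, equal one Laurent polynomial `h(x₀, x₂)`
exactly when the product and iterate series are the two binomial expansions of `z₁^(-P-ε₁/2)
z₂^(-ε₂/2) h(z₁ - z₂, z₂)`. These expansions converge to that function in the two regions
(`hasSum_productTerm`, `hasSum_iterateTerm`). Conversely, convergence determines the coefficients
(`dual_productCoeff_of_hasSum`, `dual_iterateCoeff_of_hasSum`), and `W'` separates points of `W`.
The exponents correspond by `q₁ = P + ε₁` in one direction and `P = q₁` in the other. -/

/-! ### Formal substitutions along rays, and their inverses. -/

/-- The family of coefficients `γ r` placed at the points `p - r • δ` of `ℤ × ℤ`. -/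
noncomputable def rayCoeff (δ : ℤ × ℤ) (γ : ℕ → ℂ) (p : ℤ × ℤ) : ℤ × ℤ → ℂ :=
  Function.extend (fun r : ℕ => p - r • δ) γ 0

/-- The operator `c ↦ (x ↦ ∑ₖ β x k * c (x + k • δ))` on families of coefficients. -/
noncomputable def shiftSum (δ : ℤ × ℤ) (β : ℤ × ℤ → ℕ → ℂ) (c : ℤ × ℤ → ℂ) (x : ℤ × ℤ) : ℂ :=
  ∑ᶠ k : ℕ, β x k * c (x + k • δ)

/-- The coefficients of the expansion of a Laurent polynomial `h`, where the monomial at `p` is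
expanded along the ray `p - r • δ` with coefficients `γ p r`. -/
noncomputable def rayExpansion (δ : ℤ × ℤ) (γ : ℤ × ℤ → ℕ → ℂ) (h : ℤ × ℤ →₀ ℂ) (x : ℤ × ℤ) : ℂ :=
  h.sum fun p a => a * rayCoeff δ (γ p) p x

theorem ray_injective {δ : ℤ × ℤ} (hδ : δ ≠ 0) (p : ℤ × ℤ) :
    Function.Injective fun r : ℕ => p - r • δ := by
  intro r s h
  have h1 : r • δ = s • δ := sub_right_injective h
  have h2 : ((r : ℤ) - s) • δ = 0 := by
    rw [sub_smul, natCast_zsmul, natCast_zsmul, h1, sub_self]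
  rcases smul_eq_zero.1 h2 with h3 | h3
  · omega
  · exact absurd h3 hδ

theorem rayCoeff_apply {δ : ℤ × ℤ} (hδ : δ ≠ 0) (γ : ℕ → ℂ) (p : ℤ × ℤ) (r : ℕ) :
    rayCoeff δ γ p (p - r • δ) = γ r :=
  (ray_injective hδ p).extend_apply γ 0 r

theorem rayCoeff_eq_zero {δ : ℤ × ℤ} (γ : ℕ → ℂ) (p x : ℤ × ℤ) (h : ∀ r : ℕ, x ≠ p - r • δ) :
    rayCoeff δ γ p x = 0 :=
  Function.extend_apply' _ _ _ (by rintro ⟨r, hr⟩; exact h r hr.symm)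

theorem exists_of_rayCoeff_ne_zero {δ : ℤ × ℤ} {γ : ℕ → ℂ} {p x : ℤ × ℤ}
    (h : rayCoeff δ γ p x ≠ 0) : ∃ r : ℕ, x = p - r • δ := by
  by_contra h'
  push Not at h'
  exact h (rayCoeff_eq_zero γ p x h')

theorem exists_of_rayExpansion_ne_zero {δ : ℤ × ℤ} {γ : ℤ × ℤ → ℕ → ℂ} {h : ℤ × ℤ →₀ ℂ} {x : ℤ × ℤ}
    (hx : rayExpansion δ γ h x ≠ 0) : ∃ p ∈ h.support, ∃ r : ℕ, x = p - r • δ := by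
  obtain ⟨p, hp, hne⟩ := Finset.exists_ne_zero_of_sum_ne_zero hx
  exact ⟨p, hp, exists_of_rayCoeff_ne_zero (right_ne_zero_of_mul hne)⟩

/-- Stepping by `-δ` never lowers the level, so the lowest level in the finite support of `h` is a
bound. -/
theorem exists_forall_lt_rayExpansion_eq_zero {δ : ℤ × ℤ} (γ : ℤ × ℤ → ℕ → ℂ) (lvl : ℤ × ℤ →+ ℤ)
    (hlvl : lvl δ ≤ 0) (h : ℤ × ℤ →₀ ℂ) :
    ∃ T : ℤ, ∀ x, lvl x < T → rayExpansion δ γ h x = 0 := by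
  obtain ⟨T, hT⟩ := (h.support.image lvl).bddBelow
  refine ⟨T, fun x hx => ?_⟩
  by_contra hne
  obtain ⟨p, hp, r, rfl⟩ := exists_of_rayExpansion_ne_zero hne
  have h1 : T ≤ lvl p := hT (Finset.mem_coe.2 (Finset.mem_image_of_mem lvl hp))
  rw [map_sub, map_nsmul, nsmul_eq_mul] at hx
  have : (r : ℤ) * lvl δ ≤ 0 := by nlinarith
  omega

theorem finite_degrees_rayExpansion {δ : ℤ × ℤ} (hδ : δ.1 + δ.2 = 0) (γ : ℤ × ℤ → ℕ → ℂ)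
    (h : ℤ × ℤ →₀ ℂ) :
    ∃ F : Set ℤ, F.Finite ∧ ∀ x, rayExpansion δ γ h x ≠ 0 → x.1 + x.2 ∈ F := by
  refine ⟨(fun p : ℤ × ℤ => p.1 + p.2) '' h.support, h.support.finite_toSet.image _, ?_⟩
  intro x hx
  obtain ⟨p, hp, r, rfl⟩ := exists_of_rayExpansion_ne_zero hx
  refine ⟨p, hp, ?_⟩
  show p.1 + p.2 = (p.1 - r • δ.1) + (p.2 - r • δ.2)
  rw [nsmul_eq_mul, nsmul_eq_mul]
  linear_combination (r : ℤ) * hδ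

/-- If the coefficients `β` invert the coefficients `γ`, then `shiftSum` collapses a ray. -/
theorem finite_support_and_shiftSum_rayCoeff {δ : ℤ × ℤ} (hδ : δ ≠ 0) (β : ℤ × ℤ → ℕ → ℂ)
    (γ : ℕ → ℂ) (p : ℤ × ℤ)
    (H : ∀ N : ℕ, ∑ kr ∈ Finset.HasAntidiagonal.antidiagonal N, β (p - N • δ) kr.1 * γ kr.2 =
      if N = 0 then 1 else 0) (x : ℤ × ℤ) :
    (Function.support fun k : ℕ => β x k * rayCoeff δ γ p (x + k • δ)).Finite ∧
    shiftSum δ β (rayCoeff δ γ p) x = if x = p then 1 else 0 := by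
  -- At the `N`-th point of the ray only `k ≤ N` contribute, and the sum is the convolution in `H`.
  -- If `x` is off the ray, so is every `x + k • δ`.
  by_cases hx : ∃ N : ℕ, x = p - N • δ
  · obtain ⟨N, rfl⟩ := hx
    have hz : ∀ k : ℕ, N < k → rayCoeff δ γ p (p - N • δ + k • δ) = 0 := by
      intro k hk
      apply rayCoeff_eq_zero
      intro r hr
      have h1 : ((k : ℤ) - N + r) • δ = 0 := by
        simp only [add_smul, sub_smul, natCast_zsmul]
        have := congrArg (fun y => y - p + r • δ) hr
        rw [show p - r • δ - p + r • δ = 0 by abel] at this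
        rw [← this]; abel
      rcases smul_eq_zero.1 h1 with h3 | h3
      · omega
      · exact hδ h3
    have hs : (Function.support fun k : ℕ =>
        β (p - N • δ) k * rayCoeff δ γ p (p - N • δ + k • δ)) ⊆ ↑(Finset.range (N + 1)) := by
      intro k hk
      by_contra h
      simp only [Finset.coe_range, Set.mem_Iio, not_lt] at h
      exact hk (by simp only [hz k (by omega), mul_zero])
    refine ⟨(Finset.finite_toSet _).subset hs, ?_⟩
    rw [shiftSum, finsum_eq_sum_of_support_subset _ hs]
    have h2 : ∀ k ∈ Finset.range (N + 1),
        β (p - N • δ) k * rayCoeff δ γ p (p - N • δ + k • δ) =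
        β (p - N • δ) k * γ (N - k) := by
      intro k hk
      have hk' : k ≤ N := by simpa [Nat.lt_succ_iff] using hk
      congr 1
      have : p - N • δ + k • δ = p - (N - k) • δ := by
        obtain ⟨m, rfl⟩ := Nat.exists_eq_add_of_le hk'
        rw [Nat.add_sub_cancel_left, add_smul]; abel
      rw [this, rayCoeff_apply hδ]
    rw [Finset.sum_congr rfl h2,
      ← Finset.Nat.sum_antidiagonal_eq_sum_range_succ (fun k r => β (p - N • δ) k * γ r), H]
    congr 1
    rw [eq_iff_iff, sub_eq_self, smul_eq_zero, or_iff_left hδ]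
  · have hz : ∀ k : ℕ, rayCoeff δ γ p (x + k • δ) = 0 := by
      intro k
      apply rayCoeff_eq_zero
      intro r hr
      apply hx
      refine ⟨k + r, ?_⟩
      rw [add_smul, ← sub_sub, sub_right_comm, ← hr]; abel
    have hxp : x ≠ p := fun h => hx ⟨0, by simp [h]⟩
    simp only [shiftSum, hz, mul_zero, finsum_zero, if_neg hxp, and_true]
    exact Set.finite_empty.subset fun k hk => hk rfl

/-- A family whose `shiftSum` vanishes is zero if it is truncated below in a direction that `δ`
decreases. -/
theorem eq_zero_of_shiftSum_eq_zero {δ : ℤ × ℤ} (β : ℤ × ℤ → ℕ → ℂ) (hβ : ∀ x, β x 0 = 1)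
    (lvl : ℤ × ℤ →+ ℤ) (hlvl : lvl δ < 0) (c : ℤ × ℤ → ℂ) (T : ℤ) (hc : ∀ x, lvl x < T → c x = 0)
    (h : ∀ x, shiftSum δ β c x = 0) : c = 0 := by
  have key : ∀ n : ℕ, ∀ x, lvl x < T + n → c x = 0 := by
    intro n
    induction n with
    | zero => simpa using hc
    | succ n ih =>
      intro x hx
      have h1 := h x
      -- The term `k = 0` has coefficient `1`; those with `k > 0` sit at strictly lower levels,
      -- where `c` vanishes by induction.
      rw [shiftSum, finsum_eq_single _ 0] at h1
      · simpa [hβ] using h1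
      · intro k hk
        rw [ih, mul_zero]
        rw [map_add, map_nsmul, nsmul_eq_mul]
        push_cast at hx
        have : (k : ℤ) * lvl δ ≤ -1 := by
          have : (1 : ℤ) ≤ k := by exact_mod_cast Nat.one_le_iff_ne_zero.2 hk
          nlinarith
        omega
  funext x
  exact key (lvl x - T + 1).toNat x (by omega)

/-- For truncated families, `shiftSum` is inverse to `rayExpansion`. -/
theorem shiftSum_eq_iff_eq_rayExpansion {δ : ℤ × ℤ} (β : ℤ × ℤ → ℕ → ℂ) (hβ : ∀ x, β x 0 = 1)
    (γ : ℤ × ℤ → ℕ → ℂ)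
    (H : ∀ p, ∀ N : ℕ, ∑ kr ∈ Finset.HasAntidiagonal.antidiagonal N, β (p - N • δ) kr.1 * γ p kr.2 =
      if N = 0 then 1 else 0)
    (lvl : ℤ × ℤ →+ ℤ) (hlvl : lvl δ < 0) (c : ℤ × ℤ → ℂ) (T : ℤ) (hc : ∀ x, lvl x < T → c x = 0)
    (h : ℤ × ℤ →₀ ℂ) :
    (∀ x, shiftSum δ β c x = h x) ↔ c = rayExpansion δ γ h := by
  have hδ : δ ≠ 0 := by rintro rfl; simp at hlvl
  have hfin : ∀ x p, (Function.support fun k : ℕ =>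
      β x k * (h p * rayCoeff δ (γ p) p (x + k • δ))).Finite := by
    intro x p
    refine (finite_support_and_shiftSum_rayCoeff hδ β (γ p) p (H p) x).1.subset ?_
    intro k hk hk'
    apply hk
    simp only at hk' ⊢
    linear_combination h p * hk'
  have hexp : ∀ x, shiftSum δ β (rayExpansion δ γ h) x = h x := by
    intro x
    simp only [shiftSum, rayExpansion, Finsupp.sum, Finset.mul_sum]
    rw [finsum_sum_comm _ _ fun p _ => hfin x p]
    have h1 : ∀ p, ∑ᶠ k : ℕ, β x k * (h p * rayCoeff δ (γ p) p (x + k • δ)) =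
        if x = p then h p else 0 := by
      intro p
      have h2 := (finite_support_and_shiftSum_rayCoeff hδ β (γ p) p (H p) x)
      have h3 := mul_finsum (fun k : ℕ => β x k * rayCoeff δ (γ p) p (x + k • δ)) (h p)
      rw [← shiftSum, h2.2] at h3
      rw [finsum_congr fun k => mul_left_comm (β x k) (h p) _, ← h3]
      split_ifs <;> simp
    rw [Finset.sum_congr rfl fun p _ => h1 p]
    simp only [Finset.sum_ite_eq, Finsupp.mem_support_iff, ite_not]
    split_ifs with h0
    · exact h0.symm
    · rfl
  have hexpfin : ∀ x, (Function.support fun k : ℕ =>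
      β x k * rayExpansion δ γ h (x + k • δ)).Finite := by
    intro x
    refine (h.support.finite_toSet.biUnion fun p _ => hfin x p).subset ?_
    intro k hk
    simp only [rayExpansion, Finsupp.sum, Finset.mul_sum, Function.mem_support] at hk
    obtain ⟨p, hp, hne⟩ := Finset.exists_ne_zero_of_sum_ne_zero hk
    exact Set.mem_biUnion hp hne
  constructor
  · intro hs
    -- By `hexp` the difference of the two families is killed by `shiftSum`; it is truncated, hence
    -- zero.
    rw [← sub_eq_zero]
    have hcfin : ∀ x, (Function.support fun k : ℕ => β x k * c (x + k • δ)).Finite := by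
      intro x
      refine (Set.finite_Iic (lvl x - T).toNat).subset fun k hk => ?_
      by_contra hk'
      apply hk
      simp only [Set.mem_Iic, not_le] at hk'
      simp only
      rw [hc, mul_zero]
      rw [map_add, map_nsmul, nsmul_eq_mul]
      have : (k : ℤ) * lvl δ ≤ -k := by nlinarith
      omega
    obtain ⟨T', hT'⟩ := exists_forall_lt_rayExpansion_eq_zero γ lvl hlvl.le h
    refine eq_zero_of_shiftSum_eq_zero (δ := δ) β hβ lvl hlvl _ (min T T') ?_ ?_
    · intro x hx
      rw [Pi.sub_apply, hc x (by omega), hT' x (by omega), sub_zero]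
    · intro x
      simp only [shiftSum, Pi.sub_apply, mul_sub]
      rw [finsum_sub_distrib (hcfin x) (hexpfin x)]
      rw [← shiftSum, ← shiftSum, hs, hexp, sub_self]
  · rintro rfl
    exact hexp

/-! ### Binomial identities behind the two inversions. -/

theorem sum_antidiagonal_choose_mul_choose_neg (σ : ℂ) (N : ℕ) :
    ∑ kr ∈ Finset.HasAntidiagonal.antidiagonal N, Ring.choose σ kr.1 * Ring.choose (-σ) kr.2 =
      if N = 0 then 1 else 0 := by
  rw [← Ring.add_choose_eq N (Commute.all σ (-σ)), add_neg_cancel, Ring.choose_zero_ite]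

/-- Reflecting the upper index of the first factor turns the sum into `(-1)^N` times a Vandermonde
convolution with value `choose (N - 1) N`. -/
theorem sum_antidiagonal_choose_add_mul_choose (s : ℂ) (N : ℕ) :
    ∑ kr ∈ Finset.HasAntidiagonal.antidiagonal N,
      Ring.choose (s - N + kr.1) kr.1 * ((-1) ^ kr.2 * Ring.choose s kr.2) =
      if N = 0 then 1 else 0 := by
  have h1 : ∀ kr ∈ Finset.HasAntidiagonal.antidiagonal N,
      Ring.choose (s - N + kr.1) kr.1 * ((-1) ^ kr.2 * Ring.choose s kr.2) =
      (-1) ^ N * (Ring.choose (N - s - 1) kr.1 * Ring.choose s kr.2) := by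
    intro kr hkr
    rw [Finset.HasAntidiagonal.mem_antidiagonal] at hkr
    have h2 : Ring.choose (s - N + kr.1) kr.1 = (-1) ^ kr.1 * Ring.choose (N - s - 1) kr.1 := by
      have := Ring.choose_neg ((N : ℂ) - s - kr.1) kr.1
      rw [show -((N : ℂ) - s - kr.1) = s - N + kr.1 by ring,
       
        show (N : ℂ) - s - kr.1 + kr.1 - 1 = N - s - 1 by ring] at this
      rw [this, Units.smul_def, zsmul_eq_mul]
      simp [Int.negOnePow_def]
    rw [h2, ← hkr, pow_add]; push_cast; ring
  rw [Finset.sum_congr rfl h1, ← Finset.mul_sum, ← Ring.add_choose_eq N (Commute.all _ s)]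
  rw [show (N : ℂ) - s - 1 + s = ((N : ℤ) - 1 : ℤ) by push_cast; ring]
  rcases N with _ | N
  · simp
  · have : (((((N + 1 : ℕ) : ℤ) - 1 : ℤ)) : ℂ) = (N : ℕ) := by push_cast; ring
    rw [this, Ring.choose_natCast, Nat.choose_succ_self]
    simp

/-! ### Uniqueness of coefficients from values at real points. -/

/-- The real zeros accumulate at `0`, so the identity theorem applies to the analytic sum. -/
theorem eq_zero_of_hasSum_mul_pow_eq_zero (a : ℕ → ℂ)
    (h : ∀ u : ℝ, 0 < u → u < 1 → HasSum (fun r => a r * (u : ℂ) ^ r) 0) : a = 0 := by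
  set p : FormalMultilinearSeries ℂ ℂ ℂ := FormalMultilinearSeries.ofScalars ℂ a with hp
  have hr : ((1 / 2 : NNReal) : ENNReal) ≤ p.radius := by
    apply p.le_radius_of_summable_norm
    have h1 := (h (1 / 2) (by norm_num) (by norm_num)).summable.norm
    refine h1.congr fun r => ?_
    simp [hp]
  have hf := p.hasFPowerSeriesOnBall (lt_of_lt_of_le (by norm_num) hr)
  have hfreq : ∃ᶠ z in nhdsWithin (0 : ℂ) {0}ᶜ, p.sum z = 0 := by
    rw [frequently_nhdsWithin_iff, Metric.nhds_basis_ball.frequently_iff]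
    intro ε hε
    have hm : 0 < min ε 1 / 2 := by positivity
    have h1 : min ε 1 / 2 < 1 := by have := min_le_right ε 1; linarith
    have h2 : min ε 1 / 2 < ε := by have := min_le_left ε 1; linarith
    refine ⟨((min ε 1 / 2 : ℝ) : ℂ), ?_, ?_, ?_⟩
    · rw [mem_ball_zero_iff, Complex.norm_real, Real.norm_of_nonneg hm.le]
      exact h2
    · rw [FormalMultilinearSeries.sum, ← (h _ hm h1).tsum_eq]
      refine tsum_congr fun r => ?_
      simp [hp, mul_comm, div_pow]
    · simpa using hm.ne'
  have hev := hf.analyticAt.frequently_zero_iff_eventually_zero.1 hfreq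
  have hp0 := hf.hasFPowerSeriesAt.eq_zero_of_eventually hev
  funext r
  have h3 : p.coeff r = 0 := by
    rw [hp0]
    rfl
  simpa [hp] using h3

theorem eq_zero_of_hasSum_mul_zpow_eq_zero (a : ℤ → ℂ) (T : ℤ) (hT : ∀ n < T, a n = 0)
    (h : ∀ u : ℝ, 0 < u → u < 1 → HasSum (fun n => a n * (u : ℂ) ^ n) 0) : a = 0 := by
  have key : (fun r : ℕ => a (T + r)) = 0 := by
    apply eq_zero_of_hasSum_mul_pow_eq_zero
    intro u hu hu1
    have hinj : Function.Injective fun r : ℕ => T + (r : ℤ) := fun r s hrs => by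
      simpa using hrs
    have hu0 : (u : ℂ) ≠ 0 := by exact_mod_cast hu.ne'
    have h1 := (hinj.hasSum_iff (f := fun n => a n * (u : ℂ) ^ n) (a := 0) ?_).2 (h u hu hu1)
    · have h2 := h1.mul_left ((u : ℂ) ^ (-T))
      rw [mul_zero] at h2
      refine h2.congr_fun fun r => ?_
      simp only [Function.comp_apply]
      rw [mul_left_comm, ← zpow_add₀ hu0, neg_add_cancel_left, zpow_natCast]
    · intro n hn
      rw [hT, zero_mul]
      by_contra hn'
      exact hn ⟨(n - T).toNat, show T + ((n - T).toNat : ℤ) = n by omega⟩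
  funext n
  by_cases hn : n < T
  · exact hT n hn
  · have := congrFun key (n - T).toNat
    simp only [Pi.zero_apply] at this ⊢
    rwa [show T + ((n - T).toNat : ℤ) = n by omega] at this

/-- Uniqueness of the coefficients of a double Laurent series of bounded total degrees. -/
theorem eq_zero_of_hasSum_mul_zpow_mul_zpow_eq_zero (D : ℤ × ℤ → ℂ) (F : Set ℤ) (hF : F.Finite)
    (hDF : ∀ x, D x ≠ 0 → x.1 + x.2 ∈ F) (T : ℤ) (hT : ∀ x, x.2 < T → D x = 0)
    (h : ∀ X₁ X₂ : ℝ, 0 < X₂ → X₂ < X₁ →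
      HasSum (fun x : ℤ × ℤ => D x * ((X₁ : ℂ) ^ x.1 * (X₂ : ℂ) ^ x.2)) 0) : D = 0 := by
  -- With `X₁ = ρ` and `X₂ = ρ u` a monomial of total degree `n` becomes `ρ^n u^t`. Uniqueness is
  -- applied in `ρ` for fixed `u`, then in `u`.
  let e : ℤ × ℤ ≃ ℤ × ℤ :=
    { toFun := fun y => (y.1 - y.2, y.2)
      invFun := fun x => (x.1 + x.2, x.2)
      left_inv := fun y => by simp
      right_inv := fun x => by simp }
  have h1 : ∀ ρ u : ℝ, 0 < ρ → 0 < u → u < 1 →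
      HasSum (fun y : ℤ × ℤ => (ρ : ℂ) ^ y.1 * (D (e y) * (u : ℂ) ^ y.2)) 0 := by
    intro ρ u hρ hu hu1
    have h2 := e.hasSum_iff.2 (h ρ (ρ * u) (by positivity) (by nlinarith))
    have hρ0 : (ρ : ℂ) ≠ 0 := by exact_mod_cast hρ.ne'
    refine h2.congr_fun fun y => ?_
    simp only [Function.comp_apply, e, Equiv.coe_fn_mk]
    rw [Complex.ofReal_mul, mul_zpow, zpow_sub₀ hρ0]
    field_simp
  have h2 : ∀ u : ℝ, 0 < u → u < 1 → ∀ n : ℤ,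
      HasSum (fun t : ℤ => D (n - t, t) * (u : ℂ) ^ t) 0 := by
    intro u hu hu1
    have hs : ∀ n : ℤ, Summable fun t : ℤ => D (n - t, t) * (u : ℂ) ^ t := by
      intro n
      have := (h1 1 u one_pos hu hu1).summable.prod_factor n
      simpa [e] using this
    suffices hz : (fun n : ℤ => ∑' t : ℤ, D (n - t, t) * (u : ℂ) ^ t) = 0 by
      intro n
      have := (hs n).hasSum
      rwa [show ∑' t : ℤ, D (n - t, t) * (u : ℂ) ^ t = 0 from congrFun hz n] at this
    -- Finiteness of the degrees makes the series in `ρ` a Laurent series bounded below.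
    obtain ⟨L, hL⟩ := hF.bddBelow
    refine eq_zero_of_hasSum_mul_zpow_eq_zero _ L ?_ ?_
    · intro n hn
      have : ∀ t : ℤ, D (n - t, t) = 0 := by
        intro t
        by_contra hne
        have := hL (hDF _ hne)
        simp only at this
        omega
      simp [this]
    · intro ρ hρ _
      refine HasSum.prod_fiberwise (h1 ρ u hρ hu hu1) fun n => ?_
      have := ((hs n).hasSum).mul_left ((ρ : ℂ) ^ n)
      rw [mul_comm]
      exact this
  have h3 : ∀ n : ℤ, (fun t : ℤ => D (n - t, t)) = 0 := fun n =>
    eq_zero_of_hasSum_mul_zpow_eq_zero _ T (fun t ht => hT _ ht) fun u hu hu1 => h2 u hu hu1 n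
  funext x
  have := congrFun (h3 (x.1 + x.2)) x.2
  simpa using this

/-! ### Branches of powers and convergence of binomial series. -/

theorem exp_branchLog (p : ℤ) {z : ℂ} (hz : z ≠ 0) : Complex.exp (branchLog p z) = z := by
  have h1 : ∃ n : ℤ, (argNonneg z : ℂ) + 2 * Real.pi * p = z.arg + n * (2 * Real.pi) := by
    unfold argNonneg
    split_ifs
    · exact ⟨p, by ring⟩
    · exact ⟨p + 1, by push_cast; ring⟩
  obtain ⟨n, hn⟩ := h1
  rw [branchLog, hn, mul_add, ← add_assoc,
    show Complex.I * (n * (2 * Real.pi)) = n * (2 * Real.pi * Complex.I) by ring,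
    Complex.exp_periodic.int_mul n _]
  rw [mul_comm Complex.I]
  exact Complex.exp_log hz

theorem branchPow_add (p : ℤ) (z s t : ℂ) :
    branchPow p z (s + t) = branchPow p z s * branchPow p z t := by
  rw [branchPow, add_mul, Complex.exp_add]; rfl

theorem branchPow_intCast (p : ℤ) {z : ℂ} (hz : z ≠ 0) (n : ℤ) : branchPow p z n = z ^ n := by
  rw [branchPow, Complex.exp_int_mul, exp_branchLog p hz]

theorem branchPow_ne_zero (p : ℤ) (z s : ℂ) : branchPow p z s ≠ 0 := Complex.exp_ne_zero _

theorem argNonneg_ofReal {x : ℝ} (hx : 0 ≤ x) : argNonneg (x : ℂ) = 0 := by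
  rw [argNonneg, Complex.arg_ofReal_of_nonneg hx, if_pos le_rfl]

/-- At squares of positive reals half-integral powers become integral powers of the root, so the
uniqueness lemma for Laurent series applies. -/
theorem branchPow_sq_half {X : ℝ} (hX : 0 < X) (n : ℤ) :
    branchPow 0 ((X ^ 2 : ℝ) : ℂ) ((n : ℂ) / 2) = (X : ℂ) ^ n := by
  rw [branchPow, branchLog, argNonneg_ofReal (by positivity), Complex.norm_real,
    Real.norm_of_nonneg (by positivity),
    Real.log_pow]
  have : (n : ℂ) / 2 * ((((2 : ℕ) : ℝ) * Real.log X : ℝ) +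
      Complex.I * (((0 : ℝ) : ℂ) + 2 * Real.pi * ((0 : ℤ) : ℂ))) = n * (Real.log X : ℂ) := by
    push_cast; ring
  rw [this, Complex.exp_int_mul, ← Complex.ofReal_exp, Real.exp_log hX]

/-- Both sides are logarithms of `z₁`, so they differ by `2πi n`. The quotient `z₁ / z₂` lies in the
right half-plane; together with `harg` this gives `|2πn| < π`, so `n = 0`. -/
theorem branchLog_eq_add_log (p : ℤ) {z₁ z₂ : ℂ} (h : ‖z₁ - z₂‖ < ‖z₂‖)
    (harg : |argNonneg z₁ - argNonneg z₂| < Real.pi / 2) :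
    branchLog p z₁ = branchLog p z₂ + Complex.log (1 + (z₁ - z₂) / z₂) := by
  have hz₂ : z₂ ≠ 0 := by rintro rfl; simp at h; exact absurd h (norm_nonneg _).not_gt
  have hz₁ : z₁ ≠ 0 := by rintro rfl; simp at h
  have hx : ‖(z₁ - z₂) / z₂‖ < 1 := by
    rw [norm_div, div_lt_one (norm_pos_iff.2 hz₂)]; exact h
  have hq : 1 + (z₁ - z₂) / z₂ = z₁ / z₂ := by field_simp; ring
  have hre : 0 < (1 + (z₁ - z₂) / z₂).re := by
    have := (abs_le.1 (Complex.abs_re_le_norm ((z₁ - z₂) / z₂))).1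
    rw [Complex.add_re, Complex.one_re]; linarith
  have harg' : |(1 + (z₁ - z₂) / z₂).arg| < Real.pi / 2 :=
    Complex.abs_arg_lt_pi_div_two_iff.2 (Or.inl hre)
  have hexp : Complex.exp (branchLog p z₁) =
      Complex.exp (branchLog p z₂ + Complex.log (1 + (z₁ - z₂) / z₂)) := by
    rw [Complex.exp_add, exp_branchLog p hz₁, exp_branchLog p hz₂, hq,
      Complex.exp_log (div_ne_zero hz₁ hz₂)]
    field_simp
  obtain ⟨n, hn⟩ := Complex.exp_eq_exp_iff_exists_int.1 hexp
  have him := congrArg Complex.im hn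
  simp only [branchLog, Complex.add_im, Complex.ofReal_im, Complex.mul_im, Complex.I_re,
    Complex.I_im, Complex.add_re, Complex.ofReal_re, Complex.mul_re, Complex.log_im,
    Complex.intCast_re, Complex.intCast_im, Complex.re_ofNat, Complex.im_ofNat] at him
  have hn0 : n = 0 := by
    have hpi := Real.pi_pos
    rw [abs_lt] at harg harg'
    have h1 : argNonneg z₁ - argNonneg z₂ - (1 + (z₁ - z₂) / z₂).arg = n * (2 * Real.pi) := by
      linarith
    have h2 : (n : ℝ) < 1 := by nlinarith
    have h3 : (-1 : ℝ) < n := by nlinarith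
    have h2' : n < 1 := by exact_mod_cast h2
    have h3' : -1 < n := by exact_mod_cast h3
    omega
  rw [hn, hn0]; simp

theorem hasSum_choose_mul_pow (s : ℂ) {x : ℂ} (hx : ‖x‖ < 1) :
    HasSum (fun r : ℕ => Ring.choose s r * x ^ r) ((1 + x) ^ s) := by
  have h := (Complex.one_add_cpow_hasFPowerSeriesOnBall_zero (a := s)).hasSum
    (y := x) (by
      rw [Metric.mem_eball, edist_zero_right, ← ofReal_norm,
        ENNReal.ofReal_lt_one]
      exact hx)
  rw [zero_add] at h
  refine h.congr_fun fun r => ?_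
  rw [binomialSeries_apply, List.ofFn_const, List.prod_replicate, smul_eq_mul]

theorem hasSum_rayCoeff_mul {δ : ℤ × ℤ} (hδ : δ ≠ 0) (γ : ℕ → ℂ) (p : ℤ × ℤ) (f : ℤ × ℤ → ℂ) (S : ℂ)
    (h : HasSum (fun r : ℕ => γ r * f (p - r • δ)) S) :
    HasSum (fun x => rayCoeff δ γ p x * f x) S := by
  rw [← (ray_injective hδ p).hasSum_iff]
  · refine h.congr_fun fun r => ?_
    simp only [Function.comp_apply]
    rw [rayCoeff_apply hδ]
  · intro x hx
    rw [rayCoeff_eq_zero, zero_mul]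
    exact fun r hr => hx ⟨r, hr.symm⟩

theorem hasSum_rayExpansion_mul {δ : ℤ × ℤ} (hδ : δ ≠ 0) (γ : ℤ × ℤ → ℕ → ℂ) (h : ℤ × ℤ →₀ ℂ)
    (f S : ℤ × ℤ → ℂ) (hS : ∀ p ∈ h.support, HasSum (fun r : ℕ => γ p r * f (p - r • δ)) (S p)) :
    HasSum (fun x => rayExpansion δ γ h x * f x) (h.sum fun p a => a * S p) := by
  have := hasSum_sum (s := h.support) (f := fun p x => h p * (rayCoeff δ (γ p) p x * f x))
    (a := fun p => h p * S p) fun p hp => (hasSum_rayCoeff_mul hδ _ p f _ (hS p hp)).mul_left (h p)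
  refine this.congr_fun fun x => ?_
  rw [rayExpansion, Finsupp.sum, Finset.sum_mul]
  exact Finset.sum_congr rfl fun p _ => by ring

/-! ### Laurent polynomials with doubled exponents and their two expansions. -/

/-- The exponents, stored doubled, of a Laurent polynomial `h` are integral. -/
def EvenSupport (h : ℤ × ℤ →₀ ℂ) : Prop := ∀ x ∈ h.support, Even x.1 ∧ Even x.2

/-- The value of a Laurent polynomial with doubled exponents. -/
noncomputable def evalHalf (h : ℤ × ℤ →₀ ℂ) (y z : ℂ) : ℂ :=
  h.sum fun x a => a * (y ^ (x.1 / 2) * z ^ (x.2 / 2))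

/-- The coefficients of `(x₁ - x₂) ^ (s / 2)` expanded in nonnegative powers of `x₂`. -/
noncomputable def productRay (x : ℤ × ℤ) (r : ℕ) : ℂ := (-1) ^ r * Ring.choose ((x.1 : ℂ) / 2) r

/-- The coefficients of `(x₂ + x₀) ^ (-σ)` expanded in nonnegative powers of `x₀`. -/
noncomputable def iterateRay (σ : ℂ) (_ : ℤ × ℤ) (r : ℕ) : ℂ := Ring.choose (-σ) r

/-- For integral `i`, `(z₁ - z₂)^i = z₁^i (1 - z₂/z₁)^i` is expanded by the binomial series in
`z₂/z₁`; no branch choice enters. -/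
theorem hasSum_productExpansion (h : ℤ × ℤ →₀ ℂ) (heven : EvenSupport h) (p : ℤ) (σ τ : ℂ)
    {z₁ z₂ : ℂ} (hz₂ : 0 < ‖z₂‖) (hz : ‖z₂‖ < ‖z₁‖) :
    HasSum (fun x : ℤ × ℤ => rayExpansion (2, -2) productRay h x *
      (branchPow p z₁ ((x.1 : ℂ) / 2 + σ) * branchPow p z₂ ((x.2 : ℂ) / 2 + τ)))
      (branchPow p z₁ σ * branchPow p z₂ τ * evalHalf h (z₁ - z₂) z₂) := by
  have h₂ : z₂ ≠ 0 := norm_pos_iff.1 hz₂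
  have h₁ : z₁ ≠ 0 := norm_pos_iff.1 (hz₂.trans hz)
  have key := hasSum_rayExpansion_mul (δ := (2, -2)) (by simp) productRay h
    (fun x => branchPow p z₁ ((x.1 : ℂ) / 2 + σ) * branchPow p z₂ ((x.2 : ℂ) / 2 + τ))
    (fun x => branchPow p z₁ σ * branchPow p z₂ τ * ((z₁ - z₂) ^ (x.1 / 2) * z₂ ^ (x.2 / 2))) ?_
  · convert key using 1
    rw [evalHalf, Finsupp.sum, Finsupp.sum, Finset.mul_sum]
    exact Finset.sum_congr rfl fun x _ => by ring
  · rintro ⟨s, t⟩ hx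
    obtain ⟨⟨i, hi⟩, ⟨j, hj⟩⟩ := heven _ hx
    simp only at hi hj
    subst hi hj
    rw [show (i + i, j + j).1 / 2 = i by simp only; omega,
      show (i + i, j + j).2 / 2 = j by simp only; omega]
    have hb := (hasSum_choose_mul_pow (i : ℂ) (x := -(z₂ / z₁)) (by
      rw [norm_neg, norm_div, div_lt_one (hz₂.trans hz)]; exact hz)).mul_left
      (branchPow p z₁ σ * branchPow p z₂ τ * (z₁ ^ i * z₂ ^ j))
    rw [Complex.cpow_intCast] at hb
    rw [show (z₁ - z₂) ^ i = z₁ ^ i * (1 + -(z₂ / z₁)) ^ i by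
      rw [← mul_zpow]; congr 1; field_simp; ring, show branchPow p z₁ σ * branchPow p z₂ τ *
        (z₁ ^ i * (1 + -(z₂ / z₁)) ^ i * z₂ ^ j) = branchPow p z₁ σ * branchPow p z₂ τ *
        (z₁ ^ i * z₂ ^ j) * (1 + -(z₂ / z₁)) ^ i by ring]
    refine hb.congr_fun fun r => ?_
    · simp only [productRay]
      have e1 : ((((i + i, j + j) - r • (2, -2) : ℤ × ℤ)).1 : ℂ) / 2 + σ =
          σ + ((i - r : ℤ) : ℂ) := by
        simp; ring
      have e2 : ((((i + i, j + j) - r • (2, -2) : ℤ × ℤ)).2 : ℂ) / 2 + τ =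
          τ + ((j + r : ℤ) : ℂ) := by
        simp; ring
      have e3 : (((i + i : ℤ) : ℂ)) / 2 = i := by push_cast; ring
      rw [e1, e2, e3, branchPow_add, branchPow_add, branchPow_intCast p h₁, branchPow_intCast p h₂,
        zpow_sub₀ h₁, zpow_add₀ h₂, zpow_natCast, zpow_natCast, neg_pow (z₂ / z₁), div_pow]
      field_simp

/-- Here a non-integral power is expanded: `(z₁^(-σ))_p = (z₂^(-σ))_p (1 + (z₁ - z₂)/z₂)^(-σ)` with
the principal power on the right, by `branchLog_eq_add_log`. -/
theorem hasSum_iterateExpansion (h : ℤ × ℤ →₀ ℂ) (heven : EvenSupport h) (p : ℤ) (σ τ : ℂ)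
    {z₁ z₂ : ℂ} (hz₀ : 0 < ‖z₁ - z₂‖) (hz : ‖z₁ - z₂‖ < ‖z₂‖)
    (harg : |argNonneg z₁ - argNonneg z₂| < Real.pi / 2) :
    HasSum (fun x : ℤ × ℤ => rayExpansion (-2, 2) (iterateRay σ) h x *
      ((z₁ - z₂) ^ (x.1 / 2) * branchPow p z₂ ((x.2 : ℂ) / 2 + (-σ + τ))))
      (branchPow p z₁ (-σ) * branchPow p z₂ τ * evalHalf h (z₁ - z₂) z₂) := by
  have h₂ : z₂ ≠ 0 := norm_pos_iff.1 (hz₀.trans hz)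
  have h₀ : z₁ - z₂ ≠ 0 := norm_pos_iff.1 hz₀
  have hx1 : ‖(z₁ - z₂) / z₂‖ < 1 := by
    rw [norm_div, div_lt_one (hz₀.trans hz)]; exact hz
  have hbr : branchPow p z₁ (-σ) = branchPow p z₂ (-σ) * (1 + (z₁ - z₂) / z₂) ^ (-σ) := by
    have hne : 1 + (z₁ - z₂) / z₂ ≠ 0 := by
      intro h0
      rw [eq_neg_of_add_eq_zero_right h0, norm_neg, norm_one] at hx1
      exact lt_irrefl _ hx1
    rw [branchPow, branchPow, branchLog_eq_add_log p hz harg, Complex.cpow_def_of_ne_zero hne,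
      ← Complex.exp_add]
    ring_nf
  have key := hasSum_rayExpansion_mul (δ := (-2, 2)) (by simp) (iterateRay σ) h
    (fun x => (z₁ - z₂) ^ (x.1 / 2) * branchPow p z₂ ((x.2 : ℂ) / 2 + (-σ + τ)))
    (fun x => branchPow p z₁ (-σ) * branchPow p z₂ τ *
      ((z₁ - z₂) ^ (x.1 / 2) * z₂ ^ (x.2 / 2))) ?_
  · convert key using 1
    rw [evalHalf, Finsupp.sum, Finsupp.sum, Finset.mul_sum]
    exact Finset.sum_congr rfl fun x _ => by ring
  · rintro ⟨s, t⟩ hx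
    obtain ⟨⟨i, hi⟩, ⟨j, hj⟩⟩ := heven _ hx
    simp only at hi hj
    subst hi hj
    rw [show (i + i, j + j).1 / 2 = i by simp only; omega,
      show (i + i, j + j).2 / 2 = j by simp only; omega]
    have hb := (hasSum_choose_mul_pow (-σ) hx1).mul_left
      (branchPow p z₂ (-σ) * branchPow p z₂ τ * ((z₁ - z₂) ^ i * z₂ ^ j))
    rw [hbr, show branchPow p z₂ (-σ) * (1 + (z₁ - z₂) / z₂) ^ (-σ) * branchPow p z₂ τ *
      ((z₁ - z₂) ^ i * z₂ ^ j) = branchPow p z₂ (-σ) * branchPow p z₂ τ *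
      ((z₁ - z₂) ^ i * z₂ ^ j) * (1 + (z₁ - z₂) / z₂) ^ (-σ) by ring]
    refine hb.congr_fun fun r => ?_
    · simp only [iterateRay]
      have e1 : ((i + i, j + j) - r • (-2, 2) : ℤ × ℤ).1 / 2 = i + r := by
        simp; omega
      have e2 : ((((i + i, j + j) - r • (-2, 2) : ℤ × ℤ)).2 : ℂ) / 2 + (-σ + τ) =
          (-σ + τ) + ((j - r : ℤ) : ℂ) := by
        simp; ring
      rw [e1, e2, branchPow_add, branchPow_add, branchPow_intCast p h₂,
        zpow_sub₀ h₂, zpow_add₀ h₀, zpow_natCast, zpow_natCast, div_pow]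
      field_simp

/-! ### Weights of modes, the restricted dual, and finiteness of degrees. -/

/-- The component `w_j` satisfies `(c i - c j) • w_j = 0`, so it vanishes for `j ≠ i`. -/
theorem mem_of_apply_eq_smul {ι W : Type*} [DecidableEq ι] [AddCommGroup W] [Module ℂ W]
    (G : ι → Submodule ℂ W) (hG : DirectSum.IsInternal G) (c : ι → ℂ) (hc : Function.Injective c)
    (d : W →ₗ[ℂ] W) (hd : ∀ i, ∀ w ∈ G i, d w = c i • w) (i : ι) (w : W) (hw : d w = c i • w) :
    w ∈ G i := by
  let _ := hG.chooseDecomposition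
  have hsmul : ∀ (a : ℂ) (u : W) (j : ι),
      (DirectSum.decompose G (a • u) j : W) = a • (DirectSum.decompose G u j : W) := by
    intro a u j
    rw [DirectSum.decompose_smul]
    rfl
  have h1 : ∀ (u : W) (j : ι),
      (DirectSum.decompose G (d u) j : W) = c j • (DirectSum.decompose G u j : W) := by
    intro u j
    induction u using DirectSum.Decomposition.inductionOn G with
    | zero => simp
    | homogeneous x =>
      rename_i k
      rw [hd k x x.2, hsmul]
      by_cases hkj : k = j
      · subst hkj; rfl
      · have : (DirectSum.decompose G (x : W) j : W) = 0 :=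
          DirectSum.decompose_of_mem_ne G x.2 hkj
        rw [this, smul_zero, smul_zero]
    | add x y hx hy => simp [DirectSum.decompose_add, hx, hy]
  have h2 : ∀ j, j ≠ i → (DirectSum.decompose G w j : W) = 0 := by
    intro j hj
    have h3 := h1 w j
    rw [hw, hsmul] at h3
    have h4 : (c i - c j) • (DirectSum.decompose G w j : W) = 0 := by
      rw [sub_smul, ← h3, sub_self]
    rcases smul_eq_zero.1 h4 with h | h
    · exact absurd (hc (sub_eq_zero.1 h)).symm hj
    · exact h
  have h3 : DirectSum.decompose G w = DirectSum.of (fun j => G j) i (DirectSum.decompose G w i) := by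
    ext j
    by_cases hj : j = i
    · subst hj; simp
    · rw [h2 j hj, DirectSum.of_eq_of_ne _ _ _ hj]; rfl
  have h4 := congrArg (DirectSum.decompose G).symm h3
  rw [Equiv.symm_apply_apply, DirectSum.decompose_symm_of] at h4
  rw [h4]
  exact SetLike.coe_mem _

theorem HalfMOSVA.Y_mem_wt {V : Type*} [AddCommGroup V] [Module ℂ V] (A : HalfMOSVA V)
    {i j : ℤ} {u v : V} (hu : u ∈ A.wt i) (hv : v ∈ A.wt j) (n : ℤ) :
    A.Y n u v ∈ A.wt (i + j - 2 * n - 2) := by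
  refine mem_of_apply_eq_smul A.wt A.isInternal (fun j => (j : ℂ) / 2) ?_ A.d A.d_apply _ _ ?_
  · intro a b hab
    simpa using hab
  · have h := A.d_comm u v n
    rw [A.d_apply i u hu, A.d_apply j v hv, sub_eq_iff_eq_add] at h
    simp only [map_smul, LinearMap.smul_apply] at h
    rw [h]
    push_cast
    module

namespace PreTwistedModule

variable {V : Type*} [AddCommGroup V] [Module ℂ V] {A : HalfMOSVA V} {θ : A.Involution}
  {W : Type*} [AddCommGroup W] [Module ℂ W]

theorem Y_mem_wt (M : PreTwistedModule A θ W) {j : ℤ} {m : ℂ} {u : V} {w : W} (hu : u ∈ A.wt j)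
    (hw : w ∈ M.wt m) (k : ℤ) : M.Y k u w ∈ M.wt (m + j / 2 - k / 2 - 1) := by
  classical
  refine mem_of_apply_eq_smul M.wt M.isInternal id Function.injective_id M.d M.d_apply _ _ ?_
  have h := M.d_comm u w k
  rw [A.d_apply j u hu, M.d_apply m w hw, sub_eq_iff_eq_add] at h
  simp only [map_smul, LinearMap.smul_apply] at h
  rw [h]
  simp only [id]
  module

/-- The elements of the restricted dual separate the points of `W`. -/
theorem eq_of_forall_restrictedDual (M : PreTwistedModule A θ W) {x y : W}
    (h : ∀ w' ∈ M.restrictedDual, w' x = w' y) : x = y := by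
  classical
  let _ := M.isInternal.chooseDecomposition
  have h1 : ∀ m, DirectSum.decompose M.wt x m = DirectSum.decompose M.wt y m := by
    intro m
    rw [← sub_eq_zero, ← Module.forall_dual_apply_eq_zero_iff ℂ]
    intro f
    have h2 := h (f ∘ₗ DirectSum.component ℂ ℂ (fun m => M.wt m) m ∘ₗ
      (DirectSum.decomposeLinearEquiv M.wt).toLinearMap) ?_
    · rw [map_sub, sub_eq_zero]
      exact h2
    · refine (Set.finite_singleton m).subset ?_
      rintro n ⟨w, hw, hne⟩
      by_contra hnm
      apply hne
      have h3 : DirectSum.decompose M.wt w m = 0 :=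
        Subtype.ext (DirectSum.decompose_of_mem_ne M.wt hw hnm)
      show f (DirectSum.decompose M.wt w m) = 0
      rw [h3, map_zero]
  exact (DirectSum.decompose M.wt).injective (DFinsupp.ext h1)

/-- A family of operators of weights `a - deg / 2`, paired with an element of the restricted dual,
is nonzero in finitely many degrees only. -/
theorem finite_degrees (M : PreTwistedModule A θ W) {w' : Module.Dual ℂ W}
    (hw' : w' ∈ M.restrictedDual) {I : Type*} (B : I → W →ₗ[ℂ] W) (a : ℂ) (deg : I → ℤ)
    (hB : ∀ i, ∀ m, ∀ w ∈ M.wt m, B i w ∈ M.wt (m + a - deg i / 2)) (w : W) :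
    ∃ F : Set ℤ, F.Finite ∧ ∀ i, w' (B i w) ≠ 0 → deg i ∈ F := by
  classical
  have hw : w ∈ ⨆ j, M.wt j := by rw [M.isInternal.submodule_iSup_eq_top]; trivial
  induction hw using Submodule.iSup_induction' with
  | zero => exact ⟨∅, Set.finite_empty, by simp⟩
  | add x y _ _ hx hy =>
    obtain ⟨F, hF, hF'⟩ := hx
    obtain ⟨G, hG, hG'⟩ := hy
    refine ⟨F ∪ G, hF.union hG, fun i hi => ?_⟩
    by_contra h
    rw [Set.mem_union, not_or] at h
    apply hi
    rw [map_add, map_add, not_not.1 (mt (hF' i) h.1), not_not.1 (mt (hG' i) h.2), add_zero]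
  | mem m x hx =>
    -- On a homogeneous vector the degree determines the weight injectively, and `w'` detects only
    -- finitely many weights.
    refine ⟨(fun n : ℤ => m + a - n / 2) ⁻¹' {m | ∃ w ∈ M.wt m, w' w ≠ 0},
      Set.Finite.preimage ?_ hw', fun i hi => ⟨_, hB i m x hx, hi⟩⟩
    intro b _ c _ hbc
    simpa using hbc

theorem finite_degrees_product (M : PreTwistedModule A θ W) {w' : Module.Dual ℂ W}
    (hw' : w' ∈ M.restrictedDual) {j₁ j₂ : ℤ} {v₁ v₂ : V} (h₁ : v₁ ∈ A.wt j₁) (h₂ : v₂ ∈ A.wt j₂)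
    (w : W) : ∃ F : Set ℤ, F.Finite ∧ ∀ k l : ℤ, w' (M.Y k v₁ (M.Y l v₂ w)) ≠ 0 → k + l ∈ F := by
  obtain ⟨F, hF, hF'⟩ := M.finite_degrees hw' (I := ℤ × ℤ) (fun i => M.Y i.1 v₁ ∘ₗ M.Y i.2 v₂)
    (j₁ / 2 + j₂ / 2 - 2) (fun i => i.1 + i.2) (fun i m w hw => by
      have := M.Y_mem_wt h₁ (M.Y_mem_wt h₂ hw i.2) i.1
      rw [show m + (j₁ / 2 + j₂ / 2 - 2) - ((i.1 + i.2 : ℤ) : ℂ) / 2 =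
        m + j₂ / 2 - i.2 / 2 - 1 + j₁ / 2 - i.1 / 2 - 1 by push_cast; ring]
      exact this) w
  exact ⟨F, hF, fun k l => hF' (k, l)⟩

theorem finite_degrees_iterate (M : PreTwistedModule A θ W) {w' : Module.Dual ℂ W}
    (hw' : w' ∈ M.restrictedDual) {j₁ j₂ : ℤ} {v₁ v₂ : V} (h₁ : v₁ ∈ A.wt j₁) (h₂ : v₂ ∈ A.wt j₂)
    (w : W) : ∃ F : Set ℤ, F.Finite ∧
      ∀ m l : ℤ, w' (M.Y l (A.Y m v₁ v₂) w) ≠ 0 → 2 * m + l ∈ F := by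
  obtain ⟨F, hF, hF'⟩ := M.finite_degrees hw' (I := ℤ × ℤ) (fun i => M.Y i.2 (A.Y i.1 v₁ v₂))
    (j₁ / 2 + j₂ / 2 - 2) (fun i => 2 * i.1 + i.2) (fun i m w hw => by
      have := M.Y_mem_wt (A.Y_mem_wt h₁ h₂ i.1) hw i.2
      rw [show m + (j₁ / 2 + j₂ / 2 - 2) - ((2 * i.1 + i.2 : ℤ) : ℂ) / 2 =
        m + ((j₁ + j₂ - 2 * i.1 - 2 : ℤ) : ℂ) / 2 - i.2 / 2 - 1 by push_cast; ring]
      exact this) w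
  exact ⟨F, hF, fun k l => hF' (k, l)⟩

end PreTwistedModule

/-! ### Rational functions versus Laurent polynomials in `z₁ - z₂` and `z₂`. -/

/-- The numerator of a rational function, with its powers of `z₁`, `z₂` and `z₁ - z₂`, as a
Laurent polynomial in `z₁ - z₂` and `z₂`. -/
theorem exists_evalHalf_eq (g : MvPolynomial (Fin 2) ℂ) (e₁ e₂ q₂ q₁₂ : ℕ) :
    ∃ h : ℤ × ℤ →₀ ℂ, EvenSupport h ∧
      (∀ x ∈ h.support, -2 * (q₁₂ : ℤ) ≤ x.1 ∧ 2 * ((e₂ : ℤ) - q₂) ≤ x.2) ∧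
      ∀ z₁ z₂ : ℂ, z₂ ≠ 0 → z₁ - z₂ ≠ 0 → evalHalf h (z₁ - z₂) z₂ =
        z₁ ^ e₁ * z₂ ^ e₂ * MvPolynomial.eval ![z₁, z₂] g / (z₂ ^ q₂ * (z₁ - z₂) ^ q₁₂) := by
  -- `z₁^e₁ g` is rewritten in the variables `z₁ - z₂` and `z₂` through `z₁ = (z₁ - z₂) + z₂`.
  let G : MvPolynomial (Fin 2) ℂ := MvPolynomial.aeval
    ![MvPolynomial.X 0 + MvPolynomial.X 1, MvPolynomial.X 1] (MvPolynomial.X 0 ^ e₁ * g)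
  have hG : ∀ z₁ z₂ : ℂ, MvPolynomial.eval ![z₁ - z₂, z₂] G =
      z₁ ^ e₁ * MvPolynomial.eval ![z₁, z₂] g := by
    intro z₁ z₂
    have h1 : (MvPolynomial.aeval ![z₁ - z₂, z₂] : MvPolynomial (Fin 2) ℂ →ₐ[ℂ] ℂ).comp
        (MvPolynomial.aeval ![MvPolynomial.X 0 + MvPolynomial.X 1, MvPolynomial.X 1]) =
        MvPolynomial.aeval ![z₁, z₂] := by
      apply MvPolynomial.algHom_ext
      intro i
      fin_cases i <;> simp
    have h2 := congrArg (fun f => f (MvPolynomial.X 0 ^ e₁ * g)) h1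
    simp only [AlgHom.comp_apply] at h2
    rw [← MvPolynomial.coe_aeval_eq_eval, ← MvPolynomial.coe_aeval_eq_eval]
    refine h2.trans ?_
    simp
  let pos : (Fin 2 →₀ ℕ) → ℤ × ℤ := fun m => (2 * ((m 0 : ℤ) - q₁₂), 2 * ((m 1 : ℤ) + e₂ - q₂))
  refine ⟨∑ m ∈ G.support, Finsupp.single (pos m) (G.coeff m), ?_, ?_, ?_⟩
  · intro x hx
    obtain ⟨m, -, hm⟩ := Finset.mem_biUnion.1 (Finsupp.support_finsetSum hx)
    obtain rfl := Finset.mem_singleton.1 (Finsupp.support_single_subset hm)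
    exact ⟨even_two_mul _, even_two_mul _⟩
  · intro x hx
    obtain ⟨m, -, hm⟩ := Finset.mem_biUnion.1 (Finsupp.support_finsetSum hx)
    obtain rfl := Finset.mem_singleton.1 (Finsupp.support_single_subset hm)
    simp only [pos]
    omega
  · intro z₁ z₂ hz₂ hz₀
    rw [mul_right_comm, ← hG, MvPolynomial.eval_eq', Finset.sum_mul, Finset.sum_div, evalHalf,
      ← Finsupp.sum_finsetSum_index (by simp) (by intros; ring)]
    refine Finset.sum_congr rfl fun m _ => ?_
    rw [Finsupp.sum_single_index (by simp)]
    simp only [pos]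
    rw [Int.mul_ediv_cancel_left _ two_ne_zero, Int.mul_ediv_cancel_left _ two_ne_zero,
      zpow_sub₀ hz₀, zpow_sub₀ hz₂, zpow_add₀ hz₂]
    simp only [Fin.prod_univ_two, Matrix.cons_val_zero, Matrix.cons_val_one, zpow_natCast]
    field_simp

/-- A Laurent polynomial in `z₁ - z₂` and `z₂` as a rational function of `z₁` and `z₂`. -/
theorem exists_polynomial_eq_evalHalf (h : ℤ × ℤ →₀ ℂ) (heven : EvenSupport h) (e₂ q₂ q₁₂ : ℕ)
    (hb : ∀ x ∈ h.support, -2 * (q₁₂ : ℤ) ≤ x.1 ∧ 2 * ((e₂ : ℤ) - q₂) ≤ x.2) :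
    ∃ g : MvPolynomial (Fin 2) ℂ, ∀ z₁ z₂ : ℂ, z₂ ≠ 0 → z₁ - z₂ ≠ 0 →
      evalHalf h (z₁ - z₂) z₂ =
        z₂ ^ e₂ * MvPolynomial.eval ![z₁, z₂] g / (z₂ ^ q₂ * (z₁ - z₂) ^ q₁₂) := by
  -- Clearing denominators shifts the exponents; `hb` makes them nonnegative, so `toNat` loses
  -- nothing.
  refine ⟨∑ x ∈ h.support, MvPolynomial.C (h x) *
    ((MvPolynomial.X 0 - MvPolynomial.X 1) ^ (x.1 / 2 + q₁₂).toNat *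
      MvPolynomial.X 1 ^ (x.2 / 2 + q₂ - e₂).toNat), ?_⟩
  intro z₁ z₂ hz₂ hz₀
  rw [map_sum, Finset.mul_sum, Finset.sum_div, evalHalf, Finsupp.sum]
  refine Finset.sum_congr rfl fun x hx => ?_
  obtain ⟨h1, h2⟩ := hb x hx
  obtain ⟨h3, h4⟩ := heven x hx
  simp only [map_mul, map_pow, map_sub, MvPolynomial.eval_C, MvPolynomial.eval_X,
    Matrix.cons_val_zero, Matrix.cons_val_one]
  have e1 : (z₁ - z₂) ^ (x.1 / 2 + q₁₂).toNat = (z₁ - z₂) ^ (x.1 / 2) * (z₁ - z₂) ^ q₁₂ := by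
    rw [← zpow_natCast, ← zpow_natCast, ← zpow_add₀ hz₀]
    congr 1
    obtain ⟨i, hi⟩ := h3
    omega
  have e2 : z₂ ^ e₂ * z₂ ^ (x.2 / 2 + q₂ - e₂).toNat = z₂ ^ (x.2 / 2) * z₂ ^ q₂ := by
    rw [← zpow_natCast, ← zpow_natCast, ← zpow_natCast, ← zpow_add₀ hz₂, ← zpow_add₀ hz₂]
    congr 1
    obtain ⟨i, hi⟩ := h4
    omega
  rw [eq_div_iff (mul_ne_zero (pow_ne_zero _ hz₂) (pow_ne_zero _ hz₀)), e1]
  linear_combination -(h x * ((z₁ - z₂) ^ (x.1 / 2) * (z₁ - z₂) ^ q₁₂)) * e2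

/-! ### Matrix coefficients as ray operators, and their sums. -/

namespace PreTwistedModule

variable {V : Type*} [AddCommGroup V] [Module ℂ V] {A : HalfMOSVA V} {θ : A.Involution}
  {W : Type*} [AddCommGroup W] [Module ℂ W]

/-- The coefficient of `x₁^{s/2} x₂^{t/2}` in
`⟨w', x₁^{P + ε₁/2} x₂^{ε₂/2} Y_W(v₁, x₁) Y_W(v₂, x₂) w⟩`. -/
noncomputable def productSeries (M : PreTwistedModule A θ W) (P ε₁ ε₂ : ℕ) (w' : Module.Dual ℂ W)
    (v₁ v₂ : V) (w : W) (x : ℤ × ℤ) : ℂ :=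
  w' (M.Y (2 * P + ε₁ - 2 - x.1) v₁ (M.Y (ε₂ - 2 - x.2) v₂ w))

/-- The coefficient of `x₀^{s/2} x₂^{t/2}` in
`⟨w', x₂^{P + ε₁/2 + ε₂/2} Y_W(Y_V(v₁, x₀) v₂, x₂) w⟩`. -/
noncomputable def iterateSeries (M : PreTwistedModule A θ W) (P ε₁ ε₂ : ℕ) (w' : Module.Dual ℂ W)
    (v₁ v₂ : V) (w : W) (x : ℤ × ℤ) : ℂ :=
  if Even x.1 then w' (M.Y (2 * P + ε₁ + ε₂ - 2 - x.2) (A.Y (-1 - x.1 / 2) v₁ v₂) w) else 0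

section

variable (M : PreTwistedModule A θ W) (P ε₁ ε₂ : ℕ) (w' : Module.Dual ℂ W) (v₁ v₂ : V) (w : W)

theorem dual_productCoeff (x : ℤ × ℤ) :
    w' (M.productCoeff P ε₁ ε₂ v₁ v₂ w x.1 x.2) =
      shiftSum (2, -2) (fun x k => Ring.choose ((x.1 : ℂ) / 2 + k) k)
        (M.productSeries P ε₁ ε₂ w' v₁ v₂ w) x := by
  rw [productCoeff, shiftSum]
  refine (AddMonoidHom.map_finsum w'.toAddMonoidHom
    (M.productCoeff_support_finite P ε₁ ε₂ v₁ v₂ w x.1 x.2)).trans (finsum_congr fun k => ?_)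
  rw [LinearMap.toAddMonoidHom_coe, map_smul, smul_eq_mul, productSeries]
  have e1 : (x + k • ((2, -2) : ℤ × ℤ)).1 = x.1 + 2 * k := by simp; ring
  have e2 : (x + k • ((2, -2) : ℤ × ℤ)).2 = x.2 - 2 * k := by simp; ring
  rw [e1, e2, show 2 * (P : ℤ) + ε₁ - 2 - (x.1 + 2 * k) = 2 * P + ε₁ - 2 - 2 * k - x.1 by ring,
    show (ε₂ : ℤ) - 2 - (x.2 - 2 * k) = ε₂ - 2 + 2 * k - x.2 by ring]

theorem dual_iterateCoeff (x : ℤ × ℤ) :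
    w' (M.iterateCoeff P ε₁ ε₂ v₁ v₂ w x.1 x.2) =
      shiftSum (-2, 2) (fun _ k => Ring.choose ((P : ℂ) + ε₁ / 2) k)
        (M.iterateSeries P ε₁ ε₂ w' v₁ v₂ w) x := by
  rw [iterateCoeff, shiftSum]
  have hpar : ∀ k : ℕ, Even (x + k • ((-2, 2) : ℤ × ℤ)).1 ↔ Even x.1 := by
    intro k
    simp [Int.even_add]
  split_ifs with he
  · refine (AddMonoidHom.map_finsum w'.toAddMonoidHom
      (M.iterateCoeff_support_finite P ε₁ ε₂ v₁ v₂ w x.1 x.2)).trans (finsum_congr fun k => ?_)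
    rw [LinearMap.toAddMonoidHom_coe, map_smul, smul_eq_mul, iterateSeries,
      if_pos ((hpar k).2 he)]
    have e1 : -1 - (x + k • ((-2, 2) : ℤ × ℤ)).1 / 2 = k - 1 - x.1 / 2 := by
      have : (x + k • ((-2, 2) : ℤ × ℤ)).1 = x.1 - 2 * k := by simp; ring
      omega
    have e2 : (x + k • ((-2, 2) : ℤ × ℤ)).2 = x.2 + 2 * k := by simp; ring
    rw [e1, e2, show 2 * (P : ℤ) + ε₁ + ε₂ - 2 - (x.2 + 2 * k) =
      2 * P + ε₁ + ε₂ - 2 - 2 * k - x.2 by ring]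
  · rw [map_zero]
    refine (finsum_eq_zero_of_forall_eq_zero fun k => ?_).symm
    rw [iterateSeries, if_neg (mt (hpar k).1 he), mul_zero]

/-- A reindexing: the factors `z₁^(P + ε₁/2)` and `z₂^(ε₂/2)` put into `productSeries` are divided
out again, so any `P`, `ε₁`, `ε₂` are allowed. -/
theorem hasSum_productTerm_iff (p : ℤ) (z₁ z₂ S : ℂ) :
    HasSum (M.productTerm p w' v₁ v₂ w z₁ z₂) S ↔
      HasSum (fun x : ℤ × ℤ => M.productSeries P ε₁ ε₂ w' v₁ v₂ w x *
        (branchPow p z₁ ((x.1 : ℂ) / 2 + -(P + ε₁ / 2)) *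
          branchPow p z₂ ((x.2 : ℂ) / 2 + -(ε₂ / 2)))) S := by
  let e : ℤ × ℤ ≃ ℤ × ℤ := (Equiv.subLeft (2 * (P : ℤ) + ε₁ - 2)).prodCongr
    (Equiv.subLeft ((ε₂ : ℤ) - 2))
  rw [← e.hasSum_iff]
  refine iff_of_eq (congrArg (HasSum · S) (funext fun x => ?_))
  simp only [Function.comp_apply, e, Equiv.prodCongr_apply, Prod.map_fst, Prod.map_snd,
    Equiv.subLeft_apply,
    productTerm, productSeries]
  rw [mul_assoc]
  congr 3
  · push_cast; ring
  · push_cast; ring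

theorem hasSum_iterateTerm_iff (p : ℤ) (z₁ z₂ S : ℂ) :
    HasSum (M.iterateTerm p w' v₁ v₂ w z₁ z₂) S ↔
      HasSum (fun x : ℤ × ℤ => M.iterateSeries P ε₁ ε₂ w' v₁ v₂ w x *
        ((z₁ - z₂) ^ (x.1 / 2) *
          branchPow p z₂ ((x.2 : ℂ) / 2 + (-(P + ε₁ / 2) + -(ε₂ / 2))))) S := by
  let e : ℤ × ℤ → ℤ × ℤ := fun i => (-2 - 2 * i.1, 2 * P + ε₁ + ε₂ - 2 - i.2)
  have he : Function.Injective e := by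
    rintro ⟨a, b⟩ ⟨c, d⟩ h
    simp only [e, Prod.mk.injEq] at h ⊢
    omega
  -- The reindexing `e` misses the odd first coordinates, where `iterateSeries` is zero by its
  -- default value.
  refine Iff.trans ?_ (he.hasSum_iff ?_)
  · refine iff_of_eq (congrArg (HasSum · S) (funext fun x => ?_))
    have h1 : Even (-2 - 2 * x.1) := ⟨-1 - x.1, by ring⟩
    have h2 : (-2 - 2 * x.1) / 2 = -x.1 - 1 := by omega
    simp only [Function.comp_apply, e, iterateTerm, iterateSeries]
    rw [if_pos h1, h2, mul_assoc, show (-1 - (-x.1 - 1)) = x.1 by ring,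
      show (2 * (P : ℤ) + ε₁ + ε₂ - 2 - (2 * P + ε₁ + ε₂ - 2 - x.2)) = x.2 by ring]
    congr 3
    push_cast; ring
  · intro x hx
    have : ¬ Even x.1 := by
      rintro ⟨i, hi⟩
      refine hx ⟨(-1 - i, 2 * P + ε₁ + ε₂ - 2 - x.2), ?_⟩
      ext
      · simp [e]; omega
      · simp [e]
    rw [iterateSeries, if_neg this, zero_mul]

theorem productSeries_truncated :
    ∃ T : ℤ, ∀ x : ℤ × ℤ, x.2 < T → M.productSeries P ε₁ ε₂ w' v₁ v₂ w x = 0 := by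
  obtain ⟨N, hN⟩ := M.truncation v₂ w
  refine ⟨ε₂ - 2 - N, fun x hx => ?_⟩
  rw [productSeries, hN _ (by omega), map_zero, map_zero]

theorem iterateSeries_truncated :
    ∃ T : ℤ, ∀ x : ℤ × ℤ, x.1 < T → M.iterateSeries P ε₁ ε₂ w' v₁ v₂ w x = 0 := by
  obtain ⟨N, hN⟩ := A.truncation v₁ v₂
  refine ⟨2 * (-1 - N) , fun x hx => ?_⟩
  rw [iterateSeries, hN _ (by omega), map_zero, LinearMap.zero_apply, map_zero, ite_self]

/-- The substitution `x₁ = x₀ + x₂` is undone by `x₀ = x₁ - x₂`, expanded in powers of `x₂`;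
truncation of `Y(v₂, x₂)w` makes this legitimate. -/
theorem dual_productCoeff_eq_iff (h : ℤ × ℤ →₀ ℂ) :
    (∀ x : ℤ × ℤ, w' (M.productCoeff P ε₁ ε₂ v₁ v₂ w x.1 x.2) = h x) ↔
      M.productSeries P ε₁ ε₂ w' v₁ v₂ w = rayExpansion (2, -2) productRay h := by
  obtain ⟨T, hT⟩ := M.productSeries_truncated P ε₁ ε₂ w' v₁ v₂ w
  simp only [dual_productCoeff]
  refine shiftSum_eq_iff_eq_rayExpansion (δ := (2, -2))
    (fun x k => Ring.choose ((x.1 : ℂ) / 2 + k) k) (fun x => Ring.choose_zero_right _) productRay ?_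
    (AddMonoidHom.snd ℤ ℤ) (by simp) _ T hT h
  intro p N
  rw [← sum_antidiagonal_choose_add_mul_choose ((p.1 : ℂ) / 2) N]
  refine Finset.sum_congr rfl fun kr _ => ?_
  rw [productRay]
  have e : (((p - N • ((2, -2) : ℤ × ℤ)).1 : ℤ) : ℂ) / 2 = (p.1 : ℂ) / 2 - N := by simp; ring
  rw [e]

/-- Multiplication by `(x₂ + x₀)^(P + ε₁/2)` is undone by the inverse power; truncation of `Y_V(v₁,
x₀)v₂` makes this legitimate. -/
theorem dual_iterateCoeff_eq_iff (h : ℤ × ℤ →₀ ℂ) :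
    (∀ x : ℤ × ℤ, w' (M.iterateCoeff P ε₁ ε₂ v₁ v₂ w x.1 x.2) = h x) ↔
      M.iterateSeries P ε₁ ε₂ w' v₁ v₂ w = rayExpansion (-2, 2) (iterateRay (P + ε₁ / 2)) h := by
  obtain ⟨T, hT⟩ := M.iterateSeries_truncated P ε₁ ε₂ w' v₁ v₂ w
  simp only [dual_iterateCoeff]
  exact shiftSum_eq_iff_eq_rayExpansion (δ := (-2, 2))
    (fun _ k => Ring.choose ((P : ℂ) + ε₁ / 2) k) (fun x => Ring.choose_zero_right _)
    (iterateRay (P + ε₁ / 2)) (fun p N => sum_antidiagonal_choose_mul_choose_neg _ N)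
    (AddMonoidHom.fst ℤ ℤ) (by simp) _ T hT h

theorem hasSum_productTerm (h : ℤ × ℤ →₀ ℂ) (heven : EvenSupport h)
    (hM : ∀ x : ℤ × ℤ, w' (M.productCoeff P ε₁ ε₂ v₁ v₂ w x.1 x.2) = h x) (p : ℤ) {z₁ z₂ : ℂ}
    (hz₂ : 0 < ‖z₂‖) (hz : ‖z₂‖ < ‖z₁‖) :
    HasSum (M.productTerm p w' v₁ v₂ w z₁ z₂)
      (branchPow p z₁ (-(P + ε₁ / 2)) * branchPow p z₂ (-(ε₂ / 2)) *
        evalHalf h (z₁ - z₂) z₂) := by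
  rw [M.hasSum_productTerm_iff P ε₁ ε₂, (M.dual_productCoeff_eq_iff P ε₁ ε₂ w' v₁ v₂ w h).1 hM]
  exact hasSum_productExpansion h heven p _ _ hz₂ hz

theorem hasSum_iterateTerm (h : ℤ × ℤ →₀ ℂ) (heven : EvenSupport h)
    (hM : ∀ x : ℤ × ℤ, w' (M.iterateCoeff P ε₁ ε₂ v₁ v₂ w x.1 x.2) = h x) (p : ℤ) {z₁ z₂ : ℂ}
    (hz₀ : 0 < ‖z₁ - z₂‖) (hz : ‖z₁ - z₂‖ < ‖z₂‖)
    (harg : |argNonneg z₁ - argNonneg z₂| < Real.pi / 2) :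
    HasSum (M.iterateTerm p w' v₁ v₂ w z₁ z₂)
      (branchPow p z₁ (-(P + ε₁ / 2)) * branchPow p z₂ (-(ε₂ / 2)) *
        evalHalf h (z₁ - z₂) z₂) := by
  rw [M.hasSum_iterateTerm_iff P ε₁ ε₂, (M.dual_iterateCoeff_eq_iff P ε₁ ε₂ w' v₁ v₂ w h).1 hM]
  exact hasSum_iterateExpansion h heven p _ _ hz₀ hz harg

end

/-! ### Recovering the formal coefficients from the sums. -/

section

variable (M : PreTwistedModule A θ W) (P ε₁ ε₂ : ℕ) {w' : Module.Dual ℂ W} {v₁ v₂ : V} (w : W)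

theorem finite_degrees_productSeries (hw' : w' ∈ M.restrictedDual) {j₁ j₂ : ℤ}
    (h₁ : v₁ ∈ A.wt j₁) (h₂ : v₂ ∈ A.wt j₂) :
    ∃ F : Set ℤ, F.Finite ∧
      ∀ x, M.productSeries P ε₁ ε₂ w' v₁ v₂ w x ≠ 0 → x.1 + x.2 ∈ F := by
  obtain ⟨F, hF, hF'⟩ := M.finite_degrees_product hw' h₁ h₂ w
  refine ⟨(fun n => 2 * P + ε₁ + ε₂ - 4 - n) '' F, hF.image _, fun x hx => ?_⟩
  exact ⟨_, hF' _ _ hx, by ring⟩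

theorem finite_degrees_iterateSeries (hw' : w' ∈ M.restrictedDual) {j₁ j₂ : ℤ}
    (h₁ : v₁ ∈ A.wt j₁) (h₂ : v₂ ∈ A.wt j₂) :
    ∃ F : Set ℤ, F.Finite ∧
      ∀ x, M.iterateSeries P ε₁ ε₂ w' v₁ v₂ w x ≠ 0 → x.1 + x.2 ∈ F := by
  obtain ⟨F, hF, hF'⟩ := M.finite_degrees_iterate hw' h₁ h₂ w
  refine ⟨(fun n => 2 * P + ε₁ + ε₂ - 4 - n) '' F, hF.image _, fun x hx => ?_⟩
  rw [iterateSeries] at hx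
  obtain ⟨he, hx⟩ := ite_ne_right_iff.1 hx
  obtain ⟨i, hi⟩ := he
  refine ⟨_, hF' _ _ hx, ?_⟩
  simp only
  omega

/-- The series and the expansion of `h` have the same sum at `z₁ = X₁²`, `z₂ = X₂²`, so their
coefficients agree. -/
theorem dual_productCoeff_of_hasSum (hw' : w' ∈ M.restrictedDual) {j₁ j₂ : ℤ}
    (h₁ : v₁ ∈ A.wt j₁) (h₂ : v₂ ∈ A.wt j₂) (h : ℤ × ℤ →₀ ℂ) (heven : EvenSupport h)
    (hsum : ∀ z₁ z₂ : ℂ, 0 < ‖z₂‖ → ‖z₂‖ < ‖z₁‖ → HasSum (M.productTerm 0 w' v₁ v₂ w z₁ z₂)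
      (branchPow 0 z₁ (-(P + ε₁ / 2)) * branchPow 0 z₂ (-(ε₂ / 2)) *
        evalHalf h (z₁ - z₂) z₂)) (x : ℤ × ℤ) :
    w' (M.productCoeff P ε₁ ε₂ v₁ v₂ w x.1 x.2) = h x := by
  revert x
  rw [dual_productCoeff_eq_iff, ← sub_eq_zero]
  obtain ⟨F, hF, hF'⟩ := M.finite_degrees_productSeries P ε₁ ε₂ w hw' h₁ h₂
  obtain ⟨G, hG, hG'⟩ := finite_degrees_rayExpansion (δ := (2, -2)) (by simp) productRay h
  obtain ⟨T, hT⟩ := M.productSeries_truncated P ε₁ ε₂ w' v₁ v₂ w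
  obtain ⟨T', hT'⟩ := exists_forall_lt_rayExpansion_eq_zero (δ := (2, -2)) productRay
    (AddMonoidHom.snd ℤ ℤ) (by simp) h
  refine eq_zero_of_hasSum_mul_zpow_mul_zpow_eq_zero _ (F ∪ G) (hF.union hG) ?_ (min T T') ?_ ?_
  · intro x hx
    by_contra hn
    rw [Set.mem_union, not_or] at hn
    apply hx
    rw [Pi.sub_apply, not_not.1 (mt (hF' x) hn.1), not_not.1 (mt (hG' x) hn.2), sub_zero]
  · intro x hx
    rw [Pi.sub_apply, hT x (by omega), hT' x (by simpa using lt_of_lt_of_le hx (min_le_right _ _)),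
      sub_zero]
  · intro X₁ X₂ hX₂ hX
    have hX₁ := hX₂.trans hX
    have hz₂ : 0 < ‖((X₂ ^ 2 : ℝ) : ℂ)‖ := by
      rw [Complex.norm_real, Real.norm_of_nonneg (by positivity)]; positivity
    have hz : ‖((X₂ ^ 2 : ℝ) : ℂ)‖ < ‖((X₁ ^ 2 : ℝ) : ℂ)‖ := by
      rw [Complex.norm_real, Complex.norm_real, Real.norm_of_nonneg (by positivity),
        Real.norm_of_nonneg (by positivity)]
      gcongr
    have s1 := (M.hasSum_productTerm_iff P ε₁ ε₂ w' v₁ v₂ w 0 _ _ _).1 (hsum _ _ hz₂ hz)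
    have s2 := hasSum_productExpansion h heven 0 (-(P + ε₁ / 2)) (-(ε₂ / 2)) hz₂ hz
    have s3 := (s1.sub s2).mul_left (branchPow 0 ((X₁ ^ 2 : ℝ) : ℂ) (-(P + ε₁ / 2)) *
      branchPow 0 ((X₂ ^ 2 : ℝ) : ℂ) (-(ε₂ / 2)))⁻¹
    rw [sub_self, mul_zero] at s3
    refine s3.congr_fun fun x => ?_
    have n1 := branchPow_ne_zero 0 ((X₁ ^ 2 : ℝ) : ℂ) (-(P + ε₁ / 2))
    have n2 := branchPow_ne_zero 0 ((X₂ ^ 2 : ℝ) : ℂ) (-(ε₂ / 2))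
    rw [branchPow_add, branchPow_add, branchPow_sq_half hX₁, branchPow_sq_half hX₂, Pi.sub_apply]
    generalize branchPow 0 ((X₁ ^ 2 : ℝ) : ℂ) (-(P + ε₁ / 2)) = c at *
    field_simp

theorem dual_iterateCoeff_of_hasSum (hw' : w' ∈ M.restrictedDual) {j₁ j₂ : ℤ}
    (h₁ : v₁ ∈ A.wt j₁) (h₂ : v₂ ∈ A.wt j₂) (h : ℤ × ℤ →₀ ℂ) (heven : EvenSupport h)
    (hsum : ∀ z₁ z₂ : ℂ, 0 < ‖z₁ - z₂‖ → ‖z₁ - z₂‖ < ‖z₂‖ →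
      |argNonneg z₁ - argNonneg z₂| < Real.pi / 2 → HasSum (M.iterateTerm 0 w' v₁ v₂ w z₁ z₂)
      (branchPow 0 z₁ (-(P + ε₁ / 2)) * branchPow 0 z₂ (-(ε₂ / 2)) *
        evalHalf h (z₁ - z₂) z₂)) (x : ℤ × ℤ) :
    w' (M.iterateCoeff P ε₁ ε₂ v₁ v₂ w x.1 x.2) = h x := by
  revert x
  rw [dual_iterateCoeff_eq_iff, ← sub_eq_zero]
  obtain ⟨F, hF, hF'⟩ := M.finite_degrees_iterateSeries P ε₁ ε₂ w hw' h₁ h₂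
  obtain ⟨G, hG, hG'⟩ := finite_degrees_rayExpansion (δ := (-2, 2)) (by simp)
    (iterateRay (P + ε₁ / 2)) h
  obtain ⟨T, hT⟩ := M.iterateSeries_truncated P ε₁ ε₂ w' v₁ v₂ w
  obtain ⟨T', hT'⟩ := exists_forall_lt_rayExpansion_eq_zero (δ := (-2, 2))
    (iterateRay (P + ε₁ / 2)) (AddMonoidHom.fst ℤ ℤ) (by simp) h
  set D := M.iterateSeries P ε₁ ε₂ w' v₁ v₂ w - rayExpansion (-2, 2) (iterateRay (P + ε₁ / 2)) h
    with hD
  -- The term `(X₀²)^(x.1 / 2)` uses floor division and equals `X₀^x.1` only for even exponents; the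
  -- odd ones must be excluded separately.
  have hodd : ∀ x, ¬ Even x.1 → D x = 0 := by
    intro x hx
    rw [hD, Pi.sub_apply, iterateSeries, if_neg hx, zero_sub, neg_eq_zero]
    by_contra hne
    obtain ⟨p, hp, r, rfl⟩ := exists_of_rayExpansion_ne_zero hne
    apply hx
    obtain ⟨i, hi⟩ := (heven p hp).1
    exact ⟨i + r, by simp; omega⟩
  -- The uniqueness lemma wants the truncated variable second and smaller; here that is `x₀`.
  suffices hswap : (fun y : ℤ × ℤ => D y.swap) = 0 by
    funext x
    exact congrFun hswap x.swap
  refine eq_zero_of_hasSum_mul_zpow_mul_zpow_eq_zero _ (F ∪ G) (hF.union hG) ?_ (min T T') ?_ ?_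
  · intro x hx
    by_contra hn
    rw [add_comm, Set.mem_union, not_or] at hn
    apply hx
    rw [hD, Pi.sub_apply, not_not.1 (mt (hF' x.swap) hn.1), not_not.1 (mt (hG' x.swap) hn.2),
      sub_zero]
  · intro x hx
    rw [hD, Pi.sub_apply, hT x.swap (lt_of_lt_of_le hx (min_le_left _ _)),
      hT' x.swap (lt_of_lt_of_le hx (min_le_right _ _)), sub_zero]
  -- The test points are `z₂ = X₂²` and `z₁ = X₂² + X₀²`: both have argument `0`, and `z₁ - z₂` is a
  -- square.
  · intro X₂ X₀ hX₀ hX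
    have hX₂ := hX₀.trans hX
    have hz₀' : ((X₂ ^ 2 + X₀ ^ 2 : ℝ) : ℂ) - ((X₂ ^ 2 : ℝ) : ℂ) = (X₀ : ℂ) ^ 2 := by
      push_cast; ring
    have hn₀ : ‖((X₂ ^ 2 + X₀ ^ 2 : ℝ) : ℂ) - ((X₂ ^ 2 : ℝ) : ℂ)‖ = X₀ ^ 2 := by
      rw [hz₀', norm_pow, Complex.norm_real, Real.norm_of_nonneg hX₀.le]
    have hz₀ : 0 < ‖((X₂ ^ 2 + X₀ ^ 2 : ℝ) : ℂ) - ((X₂ ^ 2 : ℝ) : ℂ)‖ := by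
      rw [hn₀]; positivity
    have hz : ‖((X₂ ^ 2 + X₀ ^ 2 : ℝ) : ℂ) - ((X₂ ^ 2 : ℝ) : ℂ)‖ < ‖((X₂ ^ 2 : ℝ) : ℂ)‖ := by
      rw [hn₀, Complex.norm_real, Real.norm_of_nonneg (by positivity)]
      gcongr
    have harg : |argNonneg ((X₂ ^ 2 + X₀ ^ 2 : ℝ) : ℂ) - argNonneg ((X₂ ^ 2 : ℝ) : ℂ)| <
        Real.pi / 2 := by
      rw [argNonneg_ofReal (by positivity), argNonneg_ofReal (by positivity), sub_self, abs_zero]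
      positivity
    have s1 := (M.hasSum_iterateTerm_iff P ε₁ ε₂ w' v₁ v₂ w 0 _ _ _).1 (hsum _ _ hz₀ hz harg)
    have s2 := hasSum_iterateExpansion h heven 0 (P + ε₁ / 2) (-(ε₂ / 2)) hz₀ hz harg
    have s3 := (s1.sub s2).mul_left (branchPow 0 ((X₂ ^ 2 : ℝ) : ℂ)
      (-(P + ε₁ / 2) + -(ε₂ / 2)))⁻¹
    rw [sub_self, mul_zero, ← (Equiv.prodComm ℤ ℤ).hasSum_iff] at s3
    refine s3.congr_fun fun x => ?_
    have n1 := branchPow_ne_zero 0 ((X₂ ^ 2 : ℝ) : ℂ) (-(P + ε₁ / 2) + -(ε₂ / 2))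
    simp only [Function.comp_apply, Equiv.prodComm_apply]
    rw [← sub_mul, ← Pi.sub_apply, ← hD, branchPow_add 0 _ ((x.swap.2 : ℂ) / 2),
      branchPow_sq_half hX₂, hz₀']
    generalize branchPow 0 ((X₂ ^ 2 : ℝ) : ℂ) (-(P + ε₁ / 2) + -(ε₂ / 2)) = c at *
    by_cases he : Even x.swap.1
    · obtain ⟨i, hi⟩ := he
      have e1 : ((X₀ : ℂ) ^ 2) ^ (x.swap.1 / 2) = (X₀ : ℂ) ^ x.2 := by
        rw [← zpow_natCast, ← zpow_mul]
        congr 1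
        simp only [Prod.fst_swap] at hi ⊢
        omega
      rw [e1]
      simp only [Prod.snd_swap]
      field_simp
    · rw [hodd _ he]; simp

end

/-! ### The two implications. -/

theorem correlationBranch_eq (p : ℤ) (P ε₁ ε₂ : ℕ) (g : MvPolynomial (Fin 2) ℂ) (q₁ q₂ q₁₂ : ℕ)
    {z₁ z₂ : ℂ} (h₁ : z₁ ≠ 0) (h₂ : z₂ ≠ 0) :
    correlationBranch p ε₁ ε₂ g q₁ q₂ q₁₂ z₁ z₂ =
      branchPow p z₁ (-(P + ε₁ / 2)) * branchPow p z₂ (-(ε₂ / 2)) *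
        (z₁ ^ (P + ε₁) * z₂ ^ ε₂ * MvPolynomial.eval ![z₁, z₂] g /
          (z₁ ^ q₁ * (z₂ ^ q₂ * (z₁ - z₂) ^ q₁₂))) := by
  have e1 : branchPow p z₁ ((ε₁ : ℂ) / 2) = branchPow p z₁ (-(P + ε₁ / 2)) * z₁ ^ (P + ε₁) := by
    rw [← zpow_natCast, ← branchPow_intCast p h₁, ← branchPow_add]
    congr 1
    push_cast; ring
  have e2 : branchPow p z₂ ((ε₂ : ℂ) / 2) = branchPow p z₂ (-(ε₂ / 2)) * z₂ ^ ε₂ := by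
    rw [← zpow_natCast, ← branchPow_intCast p h₂, ← branchPow_add]
    congr 1
    push_cast; ring
  rw [correlationBranch, e1, e2]
  ring

theorem convergesAbsolutelyTo_iff {ι : Type*} (c : ι → ℂ) (s : ℂ) :
    ConvergesAbsolutelyTo c s ↔ HasSum c s :=
  ⟨fun h => h.2, fun h => ⟨h.summable.norm, h⟩⟩

theorem weightParity_le_one (j : ℤ) : weightParity j ≤ 1 := by
  unfold weightParity; split_ifs <;> simp

theorem ne_zero_of_norm_sub_lt {z₁ z₂ : ℂ} (h : ‖z₁ - z₂‖ < ‖z₂‖) : z₁ ≠ 0 := by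
  rintro rfl
  simp at h

theorem Associativity.weakAssociativity {M : PreTwistedModule A θ W} (hM : M.Associativity) :
    M.WeakAssociativity := by
  obtain ⟨q₁, q₂, q₁₂, H⟩ := hM
  intro j₁ v₁ hv₁ w
  -- With `P = q₁` the denominator `z₁^q₁` cancels and `z₁^ε₁` is left in the numerator, so no pole
  -- at `z₁ = 0` remains.
  refine ⟨q₁ v₁ w, fun j₂ v₂ hv₂ => ?_⟩
  set P := q₁ v₁ w
  set ε₁ := weightParity j₁
  set ε₂ := weightParity j₂
  have key : ∀ w' ∈ M.restrictedDual, ∃ h : ℤ × ℤ →₀ ℂ, EvenSupport h ∧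
      (∀ x ∈ h.support, -2 * (q₁₂ v₁ v₂ : ℤ) ≤ x.1 ∧ 2 * ((ε₂ : ℤ) - q₂ v₂ w) ≤ x.2) ∧
      (∀ x : ℤ × ℤ, w' (M.productCoeff P ε₁ ε₂ v₁ v₂ w x.1 x.2) = h x) ∧
      (∀ x : ℤ × ℤ, w' (M.iterateCoeff P ε₁ ε₂ v₁ v₂ w x.1 x.2) = h x) := by
    intro w' hw'
    obtain ⟨g, hg⟩ := H j₁ j₂ v₁ hv₁ v₂ hv₂ w w' hw'
    obtain ⟨h, heven, hb, hval⟩ := exists_evalHalf_eq g ε₁ ε₂ (q₂ v₂ w) (q₁₂ v₁ v₂)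
    have hval' : ∀ z₁ z₂ : ℂ, z₁ ≠ 0 → z₂ ≠ 0 → z₁ - z₂ ≠ 0 →
        correlationBranch 0 ε₁ ε₂ g (q₁ v₁ w) (q₂ v₂ w) (q₁₂ v₁ v₂) z₁ z₂ =
        branchPow 0 z₁ (-(P + ε₁ / 2)) * branchPow 0 z₂ (-(ε₂ / 2)) *
          evalHalf h (z₁ - z₂) z₂ := by
      intro z₁ z₂ h₁ h₂ h₁₂
      rw [correlationBranch_eq 0 P _ _ _ _ _ _ h₁ h₂, hval z₁ z₂ h₂ h₁₂, pow_add, mul_assoc (_ ^ P),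
        mul_assoc (_ ^ P), mul_div_mul_left _ _ (pow_ne_zero _ h₁)]
    refine ⟨h, heven, hb, ?_, ?_⟩
    · refine M.dual_productCoeff_of_hasSum P ε₁ ε₂ w hw' hv₁ hv₂ h heven fun z₁ z₂ hz₂ hz => ?_
      rw [← hval' z₁ z₂ (norm_pos_iff.1 (hz₂.trans hz)) (norm_pos_iff.1 hz₂)
        (sub_ne_zero.2 fun he => hz.ne' (by rw [he]))]
      exact ((hg 0 z₁ z₂).1 hz₂ hz).2
    · refine M.dual_iterateCoeff_of_hasSum P ε₁ ε₂ w hw' hv₁ hv₂ h heven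
        fun z₁ z₂ hz₀ hz harg => ?_
      rw [← hval' z₁ z₂ (ne_zero_of_norm_sub_lt hz) (norm_pos_iff.1 (hz₀.trans hz))
        (norm_pos_iff.1 hz₀)]
      exact ((hg 0 z₁ z₂).2 hz₀ hz harg).2
  -- The lower bound involves only the exponents `q₂`, `q₁₂`, not `w'`, so it holds for the
  -- vector-valued coefficients.
  refine ⟨fun a b => M.eq_of_forall_restrictedDual fun w' hw' => ?_,
    min (-2 * (q₁₂ v₁ v₂ : ℤ)) (2 * ((ε₂ : ℤ) - q₂ v₂ w)), fun a b hab => ?_⟩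
  · obtain ⟨h, -, -, hp, hi⟩ := key w' hw'
    rw [hp (a, b), hi (a, b)]
  · obtain ⟨w', hw', hne⟩ : ∃ w' ∈ M.restrictedDual,
        w' (M.iterateCoeff P ε₁ ε₂ v₁ v₂ w a b) ≠ 0 := by
      by_contra hcon
      push Not at hcon
      exact hab (M.eq_of_forall_restrictedDual fun w' hw' => by rw [hcon w' hw', map_zero])
    obtain ⟨h, heven, hb, -, hi⟩ := key w' hw'
    rw [hi (a, b)] at hne
    have hmem := Finsupp.mem_support_iff.2 hne
    have h1 := heven _ hmem
    have h2 := hb _ hmem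
    exact ⟨h1.1, h1.2, (min_le_left _ _).trans h2.1, (min_le_right _ _).trans h2.2⟩

theorem exists_pole_bound_fst (v₁ v₂ : V) : ∃ q : ℕ, ∀ (M : PreTwistedModule A θ W)
    (P ε₁ ε₂ : ℕ) (w : W) (a b : ℤ), M.iterateCoeff P ε₁ ε₂ v₁ v₂ w a b ≠ 0 →
      -2 * (q : ℤ) ≤ a := by
  obtain ⟨N, hN⟩ := A.truncation v₁ v₂
  refine ⟨(N + 1).toNat, fun M P ε₁ ε₂ w a b h => ?_⟩
  by_contra hlt
  apply h
  rw [iterateCoeff]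
  split_ifs
  · refine finsum_eq_zero_of_forall_eq_zero fun k => ?_
    rw [hN _ (by omega), map_zero, LinearMap.zero_apply, smul_zero]
  · rfl

/-- Truncation of `Y(v₂, x₂)w` bounds `b` independently of `v₁` and `P`. The generous `N + 4` covers
both parities, so `q` does not depend on `ε₂`. -/
theorem exists_pole_bound_snd (M : PreTwistedModule A θ W) (v₂ : V) (w : W) :
    ∃ q : ℕ, ∀ (P ε₁ ε₂ : ℕ) (v₁ : V) (a b : ℤ), ε₂ ≤ 1 →
      M.productCoeff P ε₁ ε₂ v₁ v₂ w a b ≠ 0 → 2 * ((ε₂ : ℤ) - q) ≤ b := by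
  obtain ⟨N, hN⟩ := M.truncation v₂ w
  refine ⟨(N + 4).toNat, fun P ε₁ ε₂ v₁ a b hε h => ?_⟩
  by_contra hlt
  apply h
  rw [productCoeff]
  refine finsum_eq_zero_of_forall_eq_zero fun k => ?_
  rw [hN _ (by omega), map_zero, smul_zero]

theorem WeakAssociativity.associativity {M : PreTwistedModule A θ W} (hM : M.WeakAssociativity) :
    M.Associativity := by
  -- `q₁` must be a function of `(v₁, w)` alone: a nonzero homogeneous vector has a unique weight,
  -- hence a well-defined parity. Other vectors get the default `0`.
  have hq₁ : ∀ (v₁ : V) (w : W), ∃ q : ℕ, ∀ j₁ : ℤ, v₁ ∈ A.wt j₁ → v₁ ≠ 0 →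
      ∃ P : ℕ, q = P + weightParity j₁ ∧ ∀ (j₂ : ℤ), ∀ v₂ ∈ A.wt j₂,
        (∀ a b : ℤ, M.productCoeff P (weightParity j₁) (weightParity j₂) v₁ v₂ w a b =
          M.iterateCoeff P (weightParity j₁) (weightParity j₂) v₁ v₂ w a b) ∧
        ∃ N : ℤ, ∀ a b : ℤ,
          M.iterateCoeff P (weightParity j₁) (weightParity j₂) v₁ v₂ w a b ≠ 0 →
            Even a ∧ Even b ∧ N ≤ a ∧ N ≤ b := by
    intro v₁ w
    by_cases hex : ∃ j₁, v₁ ∈ A.wt j₁ ∧ v₁ ≠ 0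
    · obtain ⟨j, hj, hne⟩ := hex
      obtain ⟨P, hP⟩ := hM j v₁ hj w
      refine ⟨P + weightParity j, fun j₁ hj₁ _ => ?_⟩
      let _ := A.isInternal.chooseDecomposition
      obtain rfl := DirectSum.degree_eq_of_mem_mem A.wt hj hj₁ hne
      exact ⟨P, rfl, hP⟩
    · exact ⟨0, fun j₁ hj₁ hne => absurd ⟨j₁, hj₁, hne⟩ hex⟩
  choose q₁ hq₁ using hq₁
  choose q₂ hq₂ using fun (v₂ : V) (w : W) => M.exists_pole_bound_snd v₂ w
  choose q₁₂ hq₁₂ using fun (v₁ v₂ : V) => exists_pole_bound_fst (A := A) (θ := θ) (W := W) v₁ v₂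
  refine ⟨q₁, q₂, q₁₂, fun j₁ j₂ v₁ hv₁ v₂ hv₂ w w' hw' => ?_⟩
  -- Zero lies in every weight space and has no definite parity; here `g = 0` works with any
  -- exponents.
  by_cases hv₁0 : v₁ = 0
  · subst hv₁0
    refine ⟨0, fun p z₁ z₂ => ⟨fun _ _ => ?_, fun _ _ _ => ?_⟩⟩
    · have : M.productTerm p w' 0 v₂ w z₁ z₂ = 0 := by
        funext i; simp [productTerm]
      rw [convergesAbsolutelyTo_iff, this]
      rw [correlationBranch, map_zero, zero_div, mul_zero]
      exact hasSum_zero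
    · have : M.iterateTerm p w' 0 v₂ w z₁ z₂ = 0 := by
        funext i; simp [iterateTerm]
      rw [convergesAbsolutelyTo_iff, this]
      rw [correlationBranch, map_zero, zero_div, mul_zero]
      exact hasSum_zero
  obtain ⟨P, hP, hWA⟩ := hq₁ v₁ w j₁ hv₁ hv₁0
  obtain ⟨heq, N, hN⟩ := hWA j₂ v₂ hv₂
  set ε₁ := weightParity j₁
  set ε₂ := weightParity j₂
  obtain ⟨F, hF, hF'⟩ := M.finite_degrees_productSeries P ε₁ ε₂ w hw' hv₁ hv₂
  -- Both exponents are at least `N`. Their sum is bounded above because `shiftSum` along `(2, -2)`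
  -- preserves total degree, so the support lies in a finite square.
  have hfin : (Function.support fun x : ℤ × ℤ =>
      w' (M.iterateCoeff P ε₁ ε₂ v₁ v₂ w x.1 x.2)).Finite := by
    obtain ⟨L, hL⟩ := hF.bddAbove
    refine ((Set.finite_Icc N (L - N)).prod (Set.finite_Icc N (L - N))).subset fun x hx => ?_
    have hx0 : M.iterateCoeff P ε₁ ε₂ v₁ v₂ w x.1 x.2 ≠ 0 := fun h0 => hx (by
      simp only [h0, map_zero])
    obtain ⟨-, -, ha, hb⟩ := hN _ _ hx0
    have hx1 : shiftSum (2, -2) (fun x k => Ring.choose ((x.1 : ℂ) / 2 + k) k)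
        (M.productSeries P ε₁ ε₂ w' v₁ v₂ w) x ≠ 0 := by
      rw [← dual_productCoeff, heq]
      exact hx
    obtain ⟨k, hk⟩ : ∃ k : ℕ,
        M.productSeries P ε₁ ε₂ w' v₁ v₂ w (x + k • ((2, -2) : ℤ × ℤ)) ≠ 0 := by
      by_contra hcon
      push Not at hcon
      exact hx1 (finsum_eq_zero_of_forall_eq_zero fun k => by rw [hcon, mul_zero])
    have hdeg := hL (hF' _ hk)
    simp only [Prod.fst_add, Prod.snd_add, Prod.smul_fst, Prod.smul_snd, smul_neg] at hdeg
    simp only [Set.mem_prod, Set.mem_Icc]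
    omega
  set h : ℤ × ℤ →₀ ℂ := Finsupp.ofSupportFinite _ hfin
  have hi : ∀ x : ℤ × ℤ, w' (M.iterateCoeff P ε₁ ε₂ v₁ v₂ w x.1 x.2) = h x := fun _ => rfl
  have hp : ∀ x : ℤ × ℤ, w' (M.productCoeff P ε₁ ε₂ v₁ v₂ w x.1 x.2) = h x := fun x => by
    rw [heq, hi]
  have hne : ∀ x ∈ h.support, M.iterateCoeff P ε₁ ε₂ v₁ v₂ w x.1 x.2 ≠ 0 := by
    intro x hx h0
    rw [Finsupp.mem_support_iff, ← hi, h0, map_zero] at hx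
    exact hx rfl
  have heven : EvenSupport h := fun x hx =>
    ⟨(hN _ _ (hne x hx)).1, (hN _ _ (hne x hx)).2.1⟩
  obtain ⟨g, hg⟩ := exists_polynomial_eq_evalHalf h heven ε₂ (q₂ v₂ w) (q₁₂ v₁ v₂) fun x hx =>
    ⟨hq₁₂ v₁ v₂ M P ε₁ ε₂ w _ _ (hne x hx),
      hq₂ v₂ w P ε₁ ε₂ v₁ x.1 _ (weightParity_le_one j₂) (by rw [heq]; exact hne x hx)⟩
  have hval : ∀ (p : ℤ) (z₁ z₂ : ℂ), z₁ ≠ 0 → z₂ ≠ 0 → z₁ - z₂ ≠ 0 →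
      correlationBranch p ε₁ ε₂ g (q₁ v₁ w) (q₂ v₂ w) (q₁₂ v₁ v₂) z₁ z₂ =
      branchPow p z₁ (-(P + ε₁ / 2)) * branchPow p z₂ (-(ε₂ / 2)) *
        evalHalf h (z₁ - z₂) z₂ := by
    intro p z₁ z₂ h₁ h₂ h₁₂
    rw [correlationBranch_eq p P _ _ _ _ _ _ h₁ h₂, hg z₁ z₂ h₂ h₁₂, hP, mul_assoc (_ ^ (P + ε₁)),
      mul_div_mul_left _ _ (pow_ne_zero _ h₁)]
  refine ⟨g, fun p z₁ z₂ => ⟨fun hz₂ hz => ?_, fun hz₀ hz harg => ?_⟩⟩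
  · rw [convergesAbsolutelyTo_iff, hval p z₁ z₂ (norm_pos_iff.1 (hz₂.trans hz))
      (norm_pos_iff.1 hz₂) (sub_ne_zero.2 fun he => hz.ne' (by rw [he]))]
    exact M.hasSum_productTerm P ε₁ ε₂ w' v₁ v₂ w h heven hp p hz₂ hz
  · rw [convergesAbsolutelyTo_iff, hval p z₁ z₂ (ne_zero_of_norm_sub_lt hz)
      (norm_pos_iff.1 (hz₀.trans hz)) (norm_pos_iff.1 hz₀)]
    exact M.hasSum_iterateTerm P ε₁ ε₂ w' v₁ v₂ w h heven hi p hz₀ hz harg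

end PreTwistedModule

theorem mainTheorem5 {V : Type*} [AddCommGroup V] [Module ℂ V] (A : HalfMOSVA V)
    (θ : A.Involution) {W : Type*} [AddCommGroup W] [Module ℂ W] (M : PreTwistedModule A θ W) :
    M.WeakAssociativity ↔ M.Associativity :=
  ⟨fun h => h.associativity, fun h => h.weakAssociativity⟩
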